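/- Let $R$ be a finite set of faces of one of the following two lattices in the plane: the unit squares $[i,i+1]\times[j,j+1]$ with $i,j\in\mathbb Z$ (quadriculated case), or the unit equilateral triangles of the triangular lattice (triangulated case). A tile is the union of two faces with a common side (a domino, resp. a lozenge), and a tiling of $R$ is a partition of the faces of $R$ into tiles. A site is a $2\times2$ square of four faces, resp. a hexagon formed by the six triangles around a lattice point; a site has exactly two tilings. A flip of a tiling $t$ at a site that is filled by tiles of $t$ (two dominoes, resp. three lozenges) replaces these tiles by the other tiling of the site. Two sites are disjoint if they have no face in common. Let $T$ be the graph whose vertices are the tilings of $R$ and whose edges join tilings that differ by a flip. Let $\mathcal T$ be the CW complex with vertex set the set of tilings of $R$, with one $k$-cell, a cube $[0,1]^k$, for every set of $2^k$ tilings obtained from one tiling by performing all subfamilies of a family of $k$ flips at pairwise disjoint sites ($k\ge 0$); these tilings are the corners of the cube, each coordinate of the cube corresponds to one of the $k$ sites, and each cube is glued along its facets to the cubes of the families with one flip fewer. Thus the 1-skeleton of $\mathcal T$ is $T$. Theorem 3.3. Suppose that the union of the closed faces in $R$ is a simply connected subset of the plane and that $R$ has at least one tiling. Then: 1. $\mathcal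 T$ is contractible. 2. For all tilings $t,t'$ of $R$, any two geodesics in $T$ from $t$ to $t'$ (paths with the minimal number of flips) are equivalent, that is, each can be transformed into the other by finitely many exchanges of the order of two successive flips at disjoint sites. 3. Every closed curve in $\mathcal T$ is null-homotopic: every loop based at a point $x$ of $\mathcal T$ is homotopic, relative to its endpoints, to the constant loop at $x$. -/

import Mathlib

namespace FlipComplex

/-- The combinatorial data of a lattice of unit faces in the plane `ℂ`, of the tiles made of
two adjacent faces, and of the places where a flip can be made. Only the two concrete systems
`quadriculated` and `triangulated` below are used. -/
structure TileSystem where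
  /-- the unit faces of the plane -/
  Face : Type
  [decEqFace : DecidableEq Face]
  /-- the closed polygon in the plane occupied by a face -/
  polygon : Face → Set ℂ
  /-- the tiles, as sets of faces -/
  IsTile : Finset Face → Prop
  /-- the places where flips happen (squares of side 2, resp. unit hexagons) -/
  Site : Type
  [decEqSite : DecidableEq Site]
  /-- the two ways to fill a site with tiles -/
  filling : Site → Bool → Finset (Finset Face)

attribute [instance] TileSystem.decEqFace TileSystem.decEqSite

/-- Unit squares and dominoes. The face `(i, j)` is `[i, i+1] × [j, j+1]`. The site `(i, j)` is
the square `[i, i+2] × [j, j+2]`, filled by two horizontal (`false`) or two vertical (`true`)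
dominoes; these two fillings are rotations of each other by 90°. -/
abbrev quadriculated : TileSystem where
  Face := ℤ × ℤ
  polygon f := Set.Icc (f.1 : ℝ) (f.1 + 1) ×ℂ Set.Icc (f.2 : ℝ) (f.2 + 1)
  IsTile d := ∃ i j : ℤ, d = {(i, j), (i + 1, j)} ∨ d = {(i, j), (i, j + 1)}
  Site := ℤ × ℤ
  filling s b := match b with
    | false => {{(s.1, s.2), (s.1 + 1, s.2)}, {(s.1, s.2 + 1), (s.1 + 1, s.2 + 1)}}
    | true => {{(s.1, s.2), (s.1, s.2 + 1)}, {(s.1 + 1, s.2), (s.1 + 1, s.2 + 1)}}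

/-- The point `x + y ω` of the plane, where `ω = exp(iπ/3) = 1/2 + (√3/2) i`. -/
noncomputable def oblique (p : ℝ × ℝ) : ℂ := p.1 + p.2 * ⟨1 / 2, √3 / 2⟩

/-- Unit equilateral triangles and lozenges. Write `v i j = i + j ω`. The face `(i, j, true)` is
the triangle with vertices `v i j`, `v (i+1) j`, `v i (j+1)`; the face `(i, j, false)` is the
triangle with vertices `v (i+1) j`, `v i (j+1)`, `v (i+1) (j+1)`. A lozenge consists of two
triangles with a common side. The site `(i, j)` is the hexagon of the six triangles around
`v i j`; its two fillings by three lozenges are rotations of each other by 60°. -/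
noncomputable abbrev triangulated : TileSystem where
  Face := ℤ × ℤ × Bool
  polygon f := oblique '' (match f with
    | (i, j, true) => {p | (i : ℝ) ≤ p.1 ∧ (j : ℝ) ≤ p.2 ∧ p.1 + p.2 ≤ i + j + 1}
    | (i, j, false) => {p | p.1 ≤ (i : ℝ) + 1 ∧ p.2 ≤ (j : ℝ) + 1 ∧ (i : ℝ) + j + 1 ≤ p.1 + p.2})
  IsTile d := ∃ i j : ℤ, d = {(i, j, true), (i, j, false)} ∨
    d = {(i, j, true), (i - 1, j, false)} ∨ d = {(i, j, true), (i, j - 1, false)}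
  Site := ℤ × ℤ
  filling s b := match b with
    | false => {{(s.1, s.2, true), (s.1 - 1, s.2, false)},
        {(s.1 - 1, s.2, true), (s.1 - 1, s.2 - 1, false)},
        {(s.1, s.2 - 1, true), (s.1, s.2 - 1, false)}}
    | true => {{(s.1 - 1, s.2, true), (s.1 - 1, s.2, false)},
        {(s.1, s.2 - 1, true), (s.1 - 1, s.2 - 1, false)},
        {(s.1, s.2, true), (s.1, s.2 - 1, false)}}

/-- The two kinds of planar regions. -/
inductive Lattice
  | quad
  | tri

/-- The tile system of a lattice: dominoes on squares, lozenges on triangles. -/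
noncomputable def Lattice.system : Lattice → TileSystem
  | .quad => quadriculated
  | .tri => triangulated

variable (L : TileSystem)

/-- The subset of the plane covered by finitely many faces. -/
def carrier (R : Finset L.Face) : Set ℂ := ⋃ f ∈ R, L.polygon f

/-- A tiling of the region `R`: tiles contained in `R`, such that every face of `R` lies in
exactly one of them. -/
@[ext]
structure Tiling (R : Finset L.Face) where
  tiles : Finset (Finset L.Face)
  isTile : ∀ d ∈ tiles, L.IsTile d
  subset : ∀ d ∈ tiles, d ⊆ R
  cover : ∀ f ∈ R, ∃! d, d ∈ tiles ∧ f ∈ d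

/-- The set of faces of a site. -/
def support (s : L.Site) : Finset L.Face := (L.filling s false).biUnion id

variable {L} {R : Finset L.Face}

/-- `t'` is obtained from `t` by a flip at `s`: the tiles of `t` filling `s` are lifted and
replaced by the tiles of the other filling of `s`. -/
def IsFlip (s : L.Site) (t t' : Tiling L R) : Prop :=
  ∃ b : Bool, L.filling s b ⊆ t.tiles ∧
    t'.tiles = (t.tiles \ L.filling s b) ∪ L.filling s (!b)

variable (L R)

/-- The graph of tilings: two tilings are adjacent iff they differ by a flip. -/
def flipGraph : SimpleGraph (Tiling L R) := SimpleGraph.fromRel fun t t' => ∃ s, IsFlip s t t'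

/-- A cell (cube) of the flip complex: a family of flips of a tiling at pairwise disjoint sites.
Performing any subfamily of these flips gives the corners of the cube. To have every cube
exactly once, it is recorded by its corner where all its sites carry the filling `false`. -/
structure Cell where
  corner : Tiling L R
  sites : Finset L.Site
  flippable : ∀ s ∈ sites, L.filling s false ⊆ corner.tiles
  independent : (sites : Set L.Site).PairwiseDisjoint (support L)

/-- The disjoint union of the cubes `[0,1]^k`, one for each cell with `k` sites. -/
abbrev Cubes : Type := Σ c : Cell L R, (c.sites → unitInterval)

variable {L R}

/-- The gluing of a cube to its codimension-one faces. The face where the coordinate at the site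
`s` is `0` is the cube on the remaining sites with the same corner; the face where it is `1` is
the cube on the remaining sites whose corner is flipped at `s`. -/
def Glue (p q : Cubes L R) : Prop :=
  ∃ (s : L.Site) (hs : s ∈ p.1.sites),
    q.1.sites = p.1.sites.erase s ∧
    (∀ (r : L.Site) (hr : r ∈ p.1.sites) (hr' : r ∈ q.1.sites), q.2 ⟨r, hr'⟩ = p.2 ⟨r, hr⟩) ∧
    ((p.2 ⟨s, hs⟩ = 0 ∧ q.1.corner = p.1.corner) ∨
      (p.2 ⟨s, hs⟩ = 1 ∧ IsFlip s p.1.corner q.1.corner))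

variable (L R)

/-- The flip complex: the quotient space of the disjoint union of the cubes by the gluing of
every cube to its faces. Its 1-skeleton is the graph of tilings, and it has one `k`-cell for
every cube of `k` pairwise disjoint flips. -/
abbrev Complex : Type := Quot (Glue (L := L) (R := R))

variable {L R}

/-- A walk in the graph of tilings is a geodesic if it has the minimal number of flips among
all walks with the same ends. -/
def IsGeodesic {t t' : Tiling L R} (p : (flipGraph L R).Walk t t') : Prop :=
  p.length = (flipGraph L R).dist t t'

/-- `q` is obtained from `p` by changing the order of two successive flips which act on disjoint
sites. -/
def Swap {t t' : Tiling L R} (p q : (flipGraph L R).Walk t t') : Prop :=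
  ∃ (a u u' c : Tiling L R) (p₁ : (flipGraph L R).Walk t a) (p₂ : (flipGraph L R).Walk c t')
    (h₁ : (flipGraph L R).Adj a u) (h₂ : (flipGraph L R).Adj u c)
    (h₁' : (flipGraph L R).Adj a u') (h₂' : (flipGraph L R).Adj u' c) (r s : L.Site),
    Disjoint (support L r) (support L s) ∧
    IsFlip r a u ∧ IsFlip s u c ∧ IsFlip s a u' ∧ IsFlip r u' c ∧
    p = p₁.append (.cons h₁ (.cons h₂ p₂)) ∧
    q = p₁.append (.cons h₁' (.cons h₂' p₂))

/-- Equivalence of walks: the equivalence relation generated by exchanging two successive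
disjoint flips. -/
def Equivalent {t t' : Tiling L R} (p q : (flipGraph L R).Walk t t') : Prop :=
  Relation.EqvGen Swap p q

end FlipComplex

/-!
Directing every edge of the dual graph so that the black face is on its left, the edges crossed by
the tiles of a tiling form a cochain with sum one around every face. Since `R` has no holes, the
difference of two such cochains is the coboundary of a function on the vertices, the height, which
vanishes outside the interior of `R`. A flip changes the height at its site by one, and the height
functions are closed under minima and maxima. Whenever `h < h'` somewhere, `h` can be raised at
such a vertex, so the distance of two tilings is the sum of the height differences, every flip of a
geodesic lowers one of these differences, and two flips which both start geodesics are disjoint or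
equal, which makes geodesics equivalent by induction on the length. Finally the cubes
interpolate between heights: the flip complex becomes a set of real functions which is closed under
minima and contains a path from its greatest to its least element, and taking minima with the points
of this path contracts it.
-/

theorem locallyPathConnectedSpace_biUnion_of_convex {E ι : Type*} [AddCommGroup E] [Module ℝ E]
    [TopologicalSpace E] [IsTopologicalAddGroup E] [ContinuousSMul ℝ E] [LocallyConvexSpace ℝ E]
    {s : Set ι} (hs : s.Finite) {C : ι → Set E} (hconv : ∀ i ∈ s, Convex ℝ (C i))
    (hclosed : ∀ i ∈ s, IsClosed (C i)) : LocallyPathConnectedSpace (⋃ i ∈ s, C i : Set E) := by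
  refine ⟨fun x => Filter.hasBasis_self.2 fun U hU => ?_⟩
  obtain ⟨V, hV, hVU⟩ := (mem_nhds_subtype _ x U).1 hU
  have hfar : IsClosed (⋃ i ∈ {i ∈ s | x.1 ∉ C i}, C i) :=
    (hs.subset (Set.sep_subset _ _)).isClosed_biUnion fun i hi => hclosed i hi.1
  have hxfar : x.1 ∈ (⋃ i ∈ {i ∈ s | x.1 ∉ C i}, C i)ᶜ := by simp
  obtain ⟨W, ⟨hW, hWconv⟩, hWV⟩ := (LocallyConvexSpace.convex_basis (𝕜 := ℝ) x.1).mem_iff.1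
    (Filter.inter_mem hV (hfar.isOpen_compl.mem_nhds hxfar))
  refine ⟨(↑) ⁻¹' W, continuousAt_subtype_val.preimage_mem_nhds hW, ?_,
    (Set.preimage_mono (hWV.trans Set.inter_subset_left)).trans hVU⟩
  refine Subtype.preimage_coe_self_inter _ _ ▸
    IsPathConnected.preimage_coe ?_ Set.inter_subset_left
  refine StarConvex.isPathConnected (a := x.1) (starConvex_iff_segment_subset.2 ?_)
    ⟨x.2, mem_of_mem_nhds hW⟩
  rintro z ⟨hz, hzW⟩
  refine Set.subset_inter ?_ (hWconv.segment_subset (mem_of_mem_nhds hW) hzW)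
  obtain ⟨i, hi, hzi⟩ := Set.mem_iUnion₂.1 hz
  have hxi : x.1 ∈ C i := by
    by_contra hxi
    exact (hWV hzW).2 (Set.mem_biUnion (show i ∈ {i ∈ s | x.1 ∉ C i} from ⟨hi, hxi⟩) hzi)
  exact ((hconv i hi).segment_subset hxi hzi).trans (Set.subset_biUnion_of_mem hi)

theorem exists_continuousMap_exp_eq {X : Type*} [TopologicalSpace X] [SimplyConnectedSpace X]
    [LocallyPathConnectedSpace X] (f : C(X, ℂ)) (hf : ∀ x, f x ≠ 0) :
    ∃ F : C(X, ℂ), ∀ x, Complex.exp (F x) = f x := by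
  obtain ⟨x₀⟩ : Nonempty X := inferInstance
  obtain ⟨F, ⟨-, hF⟩, -⟩ := Complex.isCoveringMapOn_exp.existsUnique_continuousMap_lifts f
    (a₀ := x₀) (e₀ := Complex.log (f x₀)) (Complex.exp_log (hf x₀)) hf
  exact ⟨F, congrFun hF⟩

theorem eq_of_exp_eq_exp {X : Type*} [TopologicalSpace X] [PreconnectedSpace X] {f g : X → ℂ}
    (hf : Continuous f) (hg : Continuous g) (h : ∀ x, Complex.exp (f x) = Complex.exp (g x))
    {x₀ : X} (h₀ : f x₀ = g x₀) : f = g :=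
  Complex.isCoveringMap_exp.eq_of_comp_eq hf hg (funext fun x => Subtype.ext (h x)) x₀ h₀

theorem div_sub_mem_slitPlane {a b z₀ : ℂ} (h : z₀ ∉ segment ℝ a b) :
    (b - z₀) / (a - z₀) ∈ Complex.slitPlane := by
  have ha : a - z₀ ≠ 0 := fun h₀ => h (sub_eq_zero.1 h₀ ▸ left_mem_segment ℝ a b)
  refine Complex.mem_slitPlane_iff_not_le_zero.2 fun hle => h ?_
  obtain ⟨r, hr, hr0⟩ : ∃ r : ℝ, (r : ℂ) = (b - z₀) / (a - z₀) ∧ r ≤ 0 := by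
    obtain ⟨hre, him⟩ := Complex.le_def.1 hle
    exact ⟨_, Complex.ext rfl him.symm, hre⟩
  have hb : b - z₀ = -r • (z₀ - a) := by
    rw [eq_div_iff ha] at hr
    rw [← hr, Complex.real_smul]
    push_cast
    ring
  rw [mem_segment_iff_sameRay, hb]
  exact SameRay.sameRay_nonneg_smul_right _ (neg_nonneg.2 hr0)

theorem exists_log_primitive {S : Set ℂ} [SimplyConnectedSpace S] [LocallyPathConnectedSpace S]
    {z₀ : ℂ} (hz₀ : z₀ ∉ S) : ∃ K : ℂ → ℂ, ∀ a b, segment ℝ a b ⊆ S →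
      K b - K a = Complex.log ((b - z₀) / (a - z₀)) := by
  classical
  have hne {z : ℂ} (hz : z ∈ S) : z - z₀ ≠ 0 := fun h => hz₀ (sub_eq_zero.1 h ▸ hz)
  obtain ⟨F, hF⟩ := exists_continuousMap_exp_eq
    (⟨fun z => z - z₀, by fun_prop⟩ : C(S, ℂ)) fun z => hne z.2
  refine ⟨fun z => if h : z ∈ S then F ⟨z, h⟩ else 0, fun a b hab => ?_⟩
  have ha := left_mem_segment ℝ a b
  have hb := right_mem_segment ℝ a b
  have hslit (z : segment ℝ a b) : ((z : ℂ) - z₀) / (a - z₀) ∈ Complex.slitPlane :=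
    div_sub_mem_slitPlane fun h => hz₀ <| hab <|
      (convex_segment a b).segment_subset ha z.2 h
  have : PreconnectedSpace (segment ℝ a b) :=
    Subtype.preconnectedSpace (convex_segment a b).isPreconnected
  have hlift : (fun z : segment ℝ a b => F (Set.inclusion hab z)) =
      fun z : segment ℝ a b => F ⟨a, hab ha⟩ + Complex.log ((z - z₀) / (a - z₀)) := by
    refine eq_of_exp_eq_exp (F.continuous.comp (continuous_inclusion hab))
      (continuous_const.add (Continuous.clog (by fun_prop) hslit)) (fun z => ?_)
      (x₀ := ⟨a, ha⟩) (by simp [Set.inclusion, div_self (hne (hab ha))])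
    rw [Complex.exp_add, Complex.exp_log (Complex.slitPlane_ne_zero (hslit z)), hF, hF]
    exact (mul_div_cancel₀ _ (hne (hab ha))).symm
  have hFb : F ⟨b, hab hb⟩ = F ⟨a, hab ha⟩ + Complex.log ((b - z₀) / (a - z₀)) :=
    congrFun hlift ⟨b, hb⟩
  beta_reduce
  rw [dif_pos (hab hb), dif_pos (hab ha), hFb, add_sub_cancel_left]

/-! ### Functions on the integer grid -/

section IntegerGrid

variable {G : Type*}

theorem eq_of_succ_eq {f : ℤ → G} (hf : ∀ n, f (n + 1) = f n) (m n : ℤ) : f m = f n := by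
  have hper : Function.Periodic f 1 := hf
  simpa using (hper.zsmul_eq m).trans (hper.zsmul_eq n).symm

theorem eq_of_grid_succ_eq {K : ℤ × ℤ → G} (h₁ : ∀ i j, K (i + 1, j) = K (i, j))
    (h₂ : ∀ i j, K (i, j + 1) = K (i, j)) (v w : ℤ × ℤ) : K v = K w :=
  (eq_of_succ_eq (f := fun i => K (i, v.2)) (fun i => h₁ i v.2) v.1 w.1).trans
    (eq_of_succ_eq (f := fun j => K (w.1, j)) (h₂ w.1) v.2 w.2)

theorem exists_finite_ne_of_grid_succ_eq_off_box {K : ℤ × ℤ → G} {N : ℤ}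
    (h : ∀ i j, N < |i| ∨ N < |j| → K (i + 1, j) = K (i, j) ∧ K (i, j + 1) = K (i, j)) :
    ∃ k, {v | K v ≠ k}.Finite := by
  refine ⟨K (N + 1, N + 1), ((Set.finite_Icc (-N) N).prod (Set.finite_Icc (-N) N)).subset ?_⟩
  rintro ⟨i, j⟩ hK
  by_contra hbox
  have hN : N < |N + 1| := (lt_add_one N).trans_le (le_abs_self _)
  have hij : N < |i| ∨ N < |j| := by
    simpa only [Set.mem_prod, Set.mem_Icc, ← abs_le, not_and_or, not_le] using hbox
  refine hK ?_
  rcases hij with hi | hj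
  · exact (eq_of_succ_eq (f := fun j => K (i, j)) (fun j => (h i j (.inl hi)).2) j (N + 1)).trans
      (eq_of_succ_eq (f := fun i => K (i, N + 1)) (fun i => (h i _ (.inr hN)).1) i (N + 1))
  · exact (eq_of_succ_eq (f := fun i => K (i, j)) (fun i => (h i j (.inr hj)).1) i (N + 1)).trans
      (eq_of_succ_eq (f := fun j => K (N + 1, j)) (fun j => (h _ j (.inl hN)).2) j (N + 1))

variable [AddCommGroup G]

theorem exists_discrete_primitive (a : ℤ → G) : ∃ A : ℤ → G, ∀ i, A (i + 1) - A i = a i := by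
  refine ⟨fun n => ∑ k ∈ Finset.Ico 0 n, a k - ∑ k ∈ Finset.Ico n 0, a k, fun i => ?_⟩
  beta_reduce
  rcases le_or_gt 0 i with hi | hi
  · rw [← Finset.insert_Ico_right_eq_Ico_add_one hi,
      Finset.sum_insert Finset.right_notMem_Ico, Finset.Ico_eq_empty_of_le hi,
      Finset.Ico_eq_empty_of_le (by lia : (0 : ℤ) ≤ i + 1)]
    simp
  · rw [← Finset.insert_Ico_add_one_left_eq_Ico hi, Finset.sum_insert (by simp),
      Finset.Ico_eq_empty_of_le hi.le, Finset.Ico_eq_empty_of_le (by lia : i + 1 ≤ (0 : ℤ))]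
    simp

theorem exists_grid_potential (h v : ℤ → ℤ → G)
    (hv : ∀ i j, h i j + v (i + 1) j = v i j + h i (j + 1)) :
    ∃ K : ℤ × ℤ → G, (∀ i j, K (i + 1, j) - K (i, j) = h i j) ∧
      ∀ i j, K (i, j + 1) - K (i, j) = v i j := by
  obtain ⟨A, hA⟩ := exists_discrete_primitive fun i => h i 0
  choose B hB using fun i => exists_discrete_primitive (v i)
  have hdefect (i j : ℤ) : B (i + 1) j - B i j - h i j = B (i + 1) 0 - B i 0 - h i 0 := by
    refine eq_of_succ_eq (f := fun j => B (i + 1) j - B i j - h i j) (fun j => ?_) j 0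
    rw [eq_add_of_sub_eq (hB i j), eq_add_of_sub_eq (hB (i + 1) j),
      eq_sub_of_add_eq' (hv i j).symm]
    abel
  refine ⟨fun p => A p.1 + (B p.1 p.2 - B p.1 0), fun i j => ?_, fun i j => ?_⟩
  · calc A (i + 1) + (B (i + 1) j - B (i + 1) 0) - (A i + (B i j - B i 0))
        = A (i + 1) - A i + (B (i + 1) j - B i j - h i j) + h i j - (B (i + 1) 0 - B i 0) := by
          abel
      _ = h i j := by rw [hA, hdefect]; abel
  · simp [hB]

end IntegerGrid

namespace FlipComplex

/-! ### The dual graph of a tile system -/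

/-- The planar graph dual to the faces of a tile system: its vertices are the sites and its regions
are the faces, coloured black and white, with every edge directed so that the black face is on its
left. A tile joins the two faces along an edge; the two fillings of a site use the edges which
leave the site (the filling `up`), resp. arrive there (the filling `!up`). The last five fields say
that the graph fills a simply connected plane. -/
structure DualGraph (L : TileSystem) where
  Edge : Type
  src : Edge → L.Site
  tgt : Edge → L.Site
  left : Edge → L.Face
  right : Edge → L.Face
  black : L.Face → Prop
  /-- the number of sides of a face -/
  deg : ℕ
  bdry : L.Face → Finset Edge
  up : L.Site → Bool
  infinite : Infinite L.Site
  deg_pos : 0 < deg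
  black_left : ∀ e, black (left e)
  not_black_right : ∀ e, ¬black (right e)
  mem_bdry : ∀ {e f}, e ∈ bdry f ↔ left e = f ∨ right e = f
  card_bdry : ∀ f, (bdry f).card = deg
  src_surjective : Function.Surjective src
  src_ne_tgt : ∀ e, src e ≠ tgt e
  edge_ext : ∀ {e e'}, left e = left e' → right e = right e' → e = e'
  isTile_iff : ∀ {d}, L.IsTile d ↔ ∃ e, d = {left e, right e}
  mem_filling_up : ∀ {s d}, d ∈ L.filling s (up s) ↔ ∃ e, src e = s ∧ d = {left e, right e}
  mem_filling_not_up : ∀ {s d},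
    d ∈ L.filling s (!up s) ↔ ∃ e, tgt e = s ∧ d = {left e, right e}
  star : ∀ {v f}, (∃ e, src e = v ∧ (left e = f ∨ right e = f)) ↔
    ∃ e, tgt e = v ∧ (left e = f ∨ right e = f)
  sum_coboundary : ∀ {G : Type} [AddCommGroup G] (K : L.Site → G) (f : L.Face),
    ∑ e ∈ bdry f, (K (tgt e) - K (src e)) = 0
  exists_potential : ∀ {G : Type} [AddCommGroup G] (φ : Edge → G),
    (∀ f, ∑ e ∈ bdry f, φ e = 0) → ∃ K : L.Site → G, ∀ e, K (tgt e) - K (src e) = φ e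
  const_of_coboundary_eq_zero : ∀ {G : Type} (K : L.Site → G),
    (∀ e, K (tgt e) = K (src e)) → ∀ v w, K v = K w
  const_on_face : ∀ {G : Type} (K : L.Site → G) (f : L.Face),
    (∀ e ∈ bdry f, K (tgt e) = K (src e)) → ∃ k, ∀ e ∈ bdry f, K (src e) = k
  const_off_finite : ∀ {G : Type} (K : L.Site → G) (R : Finset L.Face),
    (∀ e, ¬(left e ∈ R ∧ right e ∈ R) → K (tgt e) = K (src e)) → ∃ k, {v | K v ≠ k}.Finite

namespace DualGraph

variable {L : TileSystem} (M : DualGraph L) {R : Finset L.Face}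

/-- A straight-line drawing of the dual graph in which every face is a convex closed polygon, the
edges around a face being the images of one of them under the powers of a rotation about the centre
of the face. -/
structure Drawing where
  pos : L.Site → ℂ
  center : L.Face → ℂ
  convex_polygon : ∀ f, Convex ℝ (L.polygon f)
  isClosed_polygon : ∀ f, IsClosed (L.polygon f)
  src_mem_polygon : ∀ {e f}, e ∈ M.bdry f → pos (M.src e) ∈ L.polygon f
  tgt_mem_polygon : ∀ {e f}, e ∈ M.bdry f → pos (M.tgt e) ∈ L.polygon f
  center_notMem_polygon : ∀ {f f'}, f ≠ f' → center f ∉ L.polygon f'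
  rotation : ∀ f, ∃ r : ℂ, r ≠ 0 ∧ r ≠ 1 ∧
    ∀ e ∈ M.bdry f, (pos (M.tgt e) - center f) / (pos (M.src e) - center f) = r

/-- The set of faces `R` has no holes, in cohomological form: around every face outside `R`,
there is a cochain winding once around this face which vanishes on the edges of `R`. -/
def NoHoles (R : Finset L.Face) : Prop :=
  ∀ f₀ ∉ R, ∃ w : M.Edge → ℂ, (∀ e, M.left e ∈ R ∨ M.right e ∈ R → w e = 0) ∧
    ∀ f, ∑ e ∈ M.bdry f, w e = if f = f₀ then 1 else 0

namespace Drawing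

variable {M} (D : M.Drawing)

/-- The change of `log (z - z₀)` along an edge. -/
noncomputable def logIncrement (z₀ : ℂ) (e : M.Edge) : ℂ :=
  Complex.log ((D.pos (M.tgt e) - z₀) / (D.pos (M.src e) - z₀))

lemma segment_subset_polygon {e : M.Edge} {f : L.Face} (he : e ∈ M.bdry f) :
    segment ℝ (D.pos (M.src e)) (D.pos (M.tgt e)) ⊆ L.polygon f :=
  (D.convex_polygon f).segment_subset (D.src_mem_polygon he) (D.tgt_mem_polygon he)

lemma sum_logIncrement_eq_zero {z₀ : ℂ} {f : L.Face} (hz₀ : z₀ ∉ L.polygon f) :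
    ∑ e ∈ M.bdry f, D.logIncrement z₀ e = 0 := by
  obtain ⟨e₀, he₀⟩ := Finset.card_pos.1 (M.card_bdry f ▸ M.deg_pos)
  have := (D.convex_polygon f).contractibleSpace ⟨_, D.src_mem_polygon he₀⟩
  have := (D.convex_polygon f).locallyPathConnectedSpace
  obtain ⟨K, hK⟩ := exists_log_primitive hz₀
  rw [← M.sum_coboundary (fun v => K (D.pos v)) f]
  exact Finset.sum_congr rfl fun e he => (hK _ _ (D.segment_subset_polygon he)).symm

lemma sum_logIncrement_center_ne_zero (f : L.Face) :
    ∑ e ∈ M.bdry f, D.logIncrement (D.center f) e ≠ 0 := by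
  obtain ⟨r, hr0, hr1, hr⟩ := D.rotation f
  have hlog : Complex.log r ≠ 0 := fun h => hr1 (by rw [← Complex.exp_log hr0, h, Complex.exp_zero])
  have hsum : ∑ e ∈ M.bdry f, D.logIncrement (D.center f) e = M.deg * Complex.log r := by
    rw [← M.card_bdry f, ← nsmul_eq_mul]
    exact Finset.sum_eq_card_nsmul fun e he => congrArg Complex.log (hr e he)
  exact hsum ▸ mul_ne_zero (Nat.cast_ne_zero.2 M.deg_pos.ne') hlog

lemma center_notMem_carrier {f : L.Face} (hf : f ∉ R) : D.center f ∉ carrier L R := by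
  simp only [carrier, Set.mem_iUnion, not_exists]
  exact fun f' hf' => D.center_notMem_polygon (ne_of_mem_of_not_mem hf' hf).symm

/-- Around a face `f₀` outside `R`, the increments of the complex logarithm based at the centre of
`f₀` wind around `f₀` only, and they have a primitive on `R`. -/
theorem noHoles_of_simplyConnectedSpace (D : M.Drawing) [SimplyConnectedSpace (carrier L R)] :
    M.NoHoles R := by
  intro f₀ hf₀
  have : LocallyPathConnectedSpace (carrier L R) :=
    locallyPathConnectedSpace_biUnion_of_convex R.finite_toSet (fun f _ => D.convex_polygon f)
      fun f _ => D.isClosed_polygon f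
  obtain ⟨K, hK⟩ := exists_log_primitive (D.center_notMem_carrier hf₀)
  set winding : ℂ := ∑ e ∈ M.bdry f₀, D.logIncrement (D.center f₀) e
  have hvanish {e : M.Edge} {f : L.Face} (hf : f ∈ R) (he : e ∈ M.bdry f) :
      K (D.pos (M.tgt e)) - K (D.pos (M.src e)) = D.logIncrement (D.center f₀) e :=
    hK _ _ ((D.segment_subset_polygon he).trans (Set.subset_biUnion_of_mem (u := L.polygon) hf))
  refine ⟨fun e => winding⁻¹ * (D.logIncrement (D.center f₀) e -
    (K (D.pos (M.tgt e)) - K (D.pos (M.src e)))), ?_, fun f => ?_⟩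
  · rintro e (he | he) <;> beta_reduce
    · rw [hvanish he (M.mem_bdry.2 (.inl rfl)), sub_self, mul_zero]
    · rw [hvanish he (M.mem_bdry.2 (.inr rfl)), sub_self, mul_zero]
  · rw [← Finset.mul_sum, Finset.sum_sub_distrib, M.sum_coboundary (fun v => K (D.pos v)),
      sub_zero]
    split_ifs with hf
    · subst hf
      exact inv_mul_cancel₀ (D.sum_logIncrement_center_ne_zero f)
    · rw [D.sum_logIncrement_eq_zero (D.center_notMem_polygon (Ne.symm hf)), mul_zero]

end Drawing

end DualGraph

/-! ### The square lattice -/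

namespace Quad

/-- The edges of the square grid. The site `(i, j)` sits at the point `(i + 1, j + 1)`, the middle
of its square; `(i, j, true)` joins it to the site `(i + 1, j)` and `(i, j, false)` joins it to the
site `(i, j + 1)`. -/
abbrev Edge : Type := ℤ × ℤ × Bool

/-- The initial site of an edge. The parity of `i + j` decides on the direction of an edge, as
the squares `(a, b)` with `a + b` even are black and lie on the left of the edges. -/
def src : Edge → ℤ × ℤ
  | (i, j, true) => if (i + j) % 2 = 0 then (i, j) else (i + 1, j)
  | (i, j, false) => if (i + j) % 2 = 0 then (i, j + 1) else (i, j)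

/-- The final site of an edge. -/
def tgt : Edge → ℤ × ℤ
  | (i, j, true) => if (i + j) % 2 = 0 then (i + 1, j) else (i, j)
  | (i, j, false) => if (i + j) % 2 = 0 then (i, j) else (i, j + 1)

/-- The black square along an edge. -/
def left : Edge → ℤ × ℤ
  | (i, j, true) => if (i + j) % 2 = 0 then (i + 1, j + 1) else (i + 1, j)
  | (i, j, false) => if (i + j) % 2 = 0 then (i + 1, j + 1) else (i, j + 1)

/-- The white square along an edge. -/
def right : Edge → ℤ × ℤ
  | (i, j, true) => if (i + j) % 2 = 0 then (i + 1, j) else (i + 1, j + 1)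
  | (i, j, false) => if (i + j) % 2 = 0 then (i, j + 1) else (i + 1, j + 1)

/-- The four sides of a square: bottom, top, left and right. -/
def bdry (f : ℤ × ℤ) : Finset Edge :=
  {(f.1 - 1, f.2 - 1, true), (f.1 - 1, f.2, true), (f.1 - 1, f.2 - 1, false), (f.1, f.2 - 1, false)}

/-- The edges which leave a site. -/
def out (s : ℤ × ℤ) : Finset Edge :=
  if (s.1 + s.2) % 2 = 0 then {(s.1 - 1, s.2, true), (s.1, s.2, true)}
  else {(s.1, s.2 - 1, false), (s.1, s.2, false)}

/-- The edges which arrive at a site. -/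
def inn (s : ℤ × ℤ) : Finset Edge :=
  if (s.1 + s.2) % 2 = 0 then {(s.1, s.2 - 1, false), (s.1, s.2, false)}
  else {(s.1 - 1, s.2, true), (s.1, s.2, true)}

lemma mem_bdry {e : Edge} {f : ℤ × ℤ} : e ∈ bdry f ↔ left e = f ∨ right e = f := by
  obtain ⟨i, j, _ | _⟩ := e <;> grind [bdry, left, right]

lemma mem_out {e : Edge} {s : ℤ × ℤ} : e ∈ out s ↔ src e = s := by
  obtain ⟨i, j, _ | _⟩ := e <;> grind [out, src]

lemma mem_inn {e : Edge} {s : ℤ × ℤ} : e ∈ inn s ↔ tgt e = s := by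
  obtain ⟨i, j, _ | _⟩ := e <;> grind [inn, tgt]

lemma sum_bdry {G : Type*} [AddCommMonoid G] (g : Edge → G) (a b : ℤ) :
    ∑ e ∈ bdry (a, b), g e = g (a - 1, b - 1, true) + (g (a - 1, b, true) +
      (g (a - 1, b - 1, false) + g (a, b - 1, false))) := by
  rw [bdry, Finset.sum_insert, Finset.sum_insert, Finset.sum_insert, Finset.sum_singleton] <;>
    simp

lemma card_bdry (f : ℤ × ℤ) : (bdry f).card = 4 :=
  (Finset.card_eq_sum_ones _).trans (sum_bdry _ f.1 f.2)

lemma pair_horizontal (i j : ℤ) : ({left (i, j, true), right (i, j, true)} : Finset (ℤ × ℤ)) =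
    {(i + 1, j), (i + 1, j + 1)} := by
  by_cases h : (i + j) % 2 = 0 <;> simp [left, right, h, Finset.pair_comm]

lemma pair_vertical (i j : ℤ) : ({left (i, j, false), right (i, j, false)} : Finset (ℤ × ℤ)) =
    {(i, j + 1), (i + 1, j + 1)} := by
  by_cases h : (i + j) % 2 = 0 <;> simp [left, right, h, Finset.pair_comm]

lemma exists_src_eq_and_bordering_iff {v f : ℤ × ℤ} :
    (∃ e, src e = v ∧ (left e = f ∨ right e = f)) ↔
      (f.1 = v.1 ∨ f.1 = v.1 + 1) ∧ (f.2 = v.2 ∨ f.2 = v.2 + 1) := by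
  simp only [← mem_out, out]
  split_ifs <;>
    simp only [Finset.mem_insert, Finset.mem_singleton, exists_eq_or_imp, exists_eq_left] <;>
    grind [left, right]

lemma exists_tgt_eq_and_bordering_iff {v f : ℤ × ℤ} :
    (∃ e, tgt e = v ∧ (left e = f ∨ right e = f)) ↔
      (f.1 = v.1 ∨ f.1 = v.1 + 1) ∧ (f.2 = v.2 ∨ f.2 = v.2 + 1) := by
  simp only [← mem_inn, inn]
  split_ifs <;>
    simp only [Finset.mem_insert, Finset.mem_singleton, exists_eq_or_imp, exists_eq_left] <;>
    grind [left, right]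

lemma sum_coboundary {G : Type*} [AddCommGroup G] (K : ℤ × ℤ → G) (f : ℤ × ℤ) :
    ∑ e ∈ bdry f, (K (tgt e) - K (src e)) = 0 := by
  obtain ⟨a, b⟩ := f
  have hh (i j : ℤ) : K (tgt (i, j, true)) - K (src (i, j, true)) =
      if (i + j) % 2 = 0 then K (i + 1, j) - K (i, j) else K (i, j) - K (i + 1, j) := by
    simp only [src, tgt]; split_ifs <;> rfl
  have hv (i j : ℤ) : K (tgt (i, j, false)) - K (src (i, j, false)) =
      if (i + j) % 2 = 0 then K (i, j) - K (i, j + 1) else K (i, j + 1) - K (i, j) := by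
    simp only [src, tgt]; split_ifs <;> rfl
  rw [sum_bdry, hh, hh, hv, hv]
  simp only [sub_add_cancel]
  split_ifs <;> first | omega | abel

/-- The cochain `φ` with the signs of its values changed so that every horizontal edge is directed
to the right and every vertical edge upwards. -/
def gridForm {G : Type*} [Neg G] (φ : Edge → G) : Edge → G
  | (i, j, true) => if (i + j) % 2 = 0 then φ (i, j, true) else -φ (i, j, true)
  | (i, j, false) => if (i + j) % 2 = 0 then -φ (i, j, false) else φ (i, j, false)

lemma exists_potential {G : Type*} [AddCommGroup G] (φ : Edge → G)
    (hφ : ∀ f, ∑ e ∈ bdry f, φ e = 0) :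
    ∃ K : ℤ × ℤ → G, ∀ e, K (tgt e) - K (src e) = φ e := by
  have hclosed (i j : ℤ) : gridForm φ (i, j, true) + gridForm φ (i + 1, j, false) =
      gridForm φ (i, j, false) + gridForm φ (i, j + 1, true) := by
    have hsum := sum_bdry φ (i + 1) (j + 1)
    simp only [hφ, add_sub_cancel_right] at hsum
    simp only [gridForm]
    split_ifs
    any_goals omega
    · rw [← sub_eq_zero, hsum]
      abel
    · rw [eq_comm, ← sub_eq_zero, hsum]
      abel
  obtain ⟨K, hh, hv⟩ := exists_grid_potential (fun i j => gridForm φ (i, j, true))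
    (fun i j => gridForm φ (i, j, false)) hclosed
  refine ⟨K, ?_⟩
  rintro ⟨i, j, _ | _⟩
  · have hij := hv i j
    simp only [gridForm, src, tgt] at hij ⊢
    split_ifs at hij ⊢
    · rw [← neg_sub, hij, neg_neg]
    · exact hij
  · have hij := hh i j
    simp only [gridForm, src, tgt] at hij ⊢
    split_ifs at hij ⊢
    · exact hij
    · rw [← neg_sub, hij, neg_neg]

lemma apply_tgt_eq_apply_src_iff {G : Type*} (K : ℤ × ℤ → G) (i j : ℤ) :
    (K (tgt (i, j, true)) = K (src (i, j, true)) ↔ K (i + 1, j) = K (i, j)) ∧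
      (K (tgt (i, j, false)) = K (src (i, j, false)) ↔ K (i, j + 1) = K (i, j)) := by
  by_cases h : (i + j) % 2 = 0 <;> simp [src, tgt, h, eq_comm]

lemma const_of_coboundary_eq_zero {G : Type*} (K : ℤ × ℤ → G)
    (h : ∀ e, K (tgt e) = K (src e)) (v w : ℤ × ℤ) : K v = K w :=
  eq_of_grid_succ_eq (fun i j => (apply_tgt_eq_apply_src_iff K i j).1.1 (h _))
    (fun i j => (apply_tgt_eq_apply_src_iff K i j).2.1 (h _)) v w

lemma const_on_face {G : Type*} (K : ℤ × ℤ → G) (f : ℤ × ℤ)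
    (h : ∀ e ∈ bdry f, K (tgt e) = K (src e)) : ∀ e ∈ bdry f, K (src e) = K f := by
  obtain ⟨a, b⟩ := f
  simp only [bdry, Finset.forall_mem_insert, Finset.mem_singleton, forall_eq,
    apply_tgt_eq_apply_src_iff, sub_add_cancel] at h ⊢
  grind [src]

lemma const_off_finite {G : Type*} (K : ℤ × ℤ → G) (R : Finset (ℤ × ℤ))
    (h : ∀ e, ¬(left e ∈ R ∧ right e ∈ R) → K (tgt e) = K (src e)) :
    ∃ k, {v | K v ≠ k}.Finite := by
  obtain ⟨N, hN⟩ := (R.image fun f => max |f.1| |f.2|).exists_le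
  have hR (f : ℤ × ℤ) (hf : f ∈ R) : |f.1| ≤ N ∧ |f.2| ≤ N :=
    max_le_iff.1 (hN _ (Finset.mem_image_of_mem _ hf))
  have hfar (e : Edge) (he : N + 1 < |e.1| ∨ N + 1 < |e.2.1|) : ¬(left e ∈ R ∧ right e ∈ R) := by
    rintro ⟨hl, -⟩
    have := hR _ hl
    obtain ⟨i, j, _ | _⟩ := e <;> grind [left]
  refine exists_finite_ne_of_grid_succ_eq_off_box (N := N + 1) fun i j hij => ⟨?_, ?_⟩
  · exact (apply_tgt_eq_apply_src_iff K i j).1.1 (h _ (hfar _ hij))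
  · exact (apply_tgt_eq_apply_src_iff K i j).2.1 (h _ (hfar _ hij))

lemma mem_filling_iff {s : ℤ × ℤ} {d : Finset (ℤ × ℤ)} :
    (d ∈ quadriculated.filling s (decide ((s.1 + s.2) % 2 = 0)) ↔
      ∃ e, src e = s ∧ d = {left e, right e}) ∧
    (d ∈ quadriculated.filling s (!decide ((s.1 + s.2) % 2 = 0)) ↔
      ∃ e, tgt e = s ∧ d = {left e, right e}) := by
  simp only [← mem_out, ← mem_inn]
  by_cases h : (s.1 + s.2) % 2 = 0
  · simp only [h, decide_true, Bool.not_true, Finset.mem_insert, Finset.mem_singleton, out, inn,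
      if_true, exists_eq_or_imp, exists_eq_left, pair_horizontal, pair_vertical, sub_add_cancel,
      and_self]
  · simp only [h, decide_false, Bool.not_false, Finset.mem_insert, Finset.mem_singleton, out, inn,
      if_false, exists_eq_or_imp, exists_eq_left, pair_horizontal, pair_vertical, sub_add_cancel,
      and_self]

lemma isTile_iff {d : Finset (ℤ × ℤ)} :
    quadriculated.IsTile d ↔ ∃ e, d = {left e, right e} := by
  constructor
  · rintro ⟨i, j, h | h⟩
    · exact ⟨(i, j - 1, false), by rw [h, pair_vertical, sub_add_cancel]⟩
    · exact ⟨(i - 1, j, true), by rw [h, pair_horizontal, sub_add_cancel]⟩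
  · rintro ⟨⟨i, j, _ | _⟩, h⟩
    · exact ⟨i, j + 1, .inl (by rw [h, pair_vertical])⟩
    · exact ⟨i + 1, j, .inr (by rw [h, pair_horizontal])⟩

lemma edge_ext {e e' : Edge} (hl : left e = left e') (hr : right e = right e') : e = e' := by
  obtain ⟨i, j, _ | _⟩ := e <;> obtain ⟨i', j', _ | _⟩ := e' <;> grind [left, right]

/-- The dual graph of the square tiling. -/
def dualGraph : DualGraph quadriculated where
  Edge := Edge
  src := src
  tgt := tgt
  left := left
  right := right
  black f := (f.1 + f.2) % 2 = 0
  deg := 4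
  bdry := bdry
  up s := decide ((s.1 + s.2) % 2 = 0)
  infinite := inferInstanceAs (Infinite (ℤ × ℤ))
  deg_pos := by norm_num
  black_left := by rintro ⟨i, j, _ | _⟩ <;> grind [left]
  not_black_right := by rintro ⟨i, j, _ | _⟩ <;> grind [right]
  mem_bdry := mem_bdry
  card_bdry := card_bdry
  src_surjective s := by
    obtain ⟨e, he⟩ : (out s).Nonempty := by
      unfold out
      split_ifs <;> exact Finset.insert_nonempty _ _
    exact ⟨e, mem_out.1 he⟩
  src_ne_tgt := by rintro ⟨i, j, _ | _⟩ <;> grind [src, tgt]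
  edge_ext := edge_ext
  isTile_iff := isTile_iff
  mem_filling_up := mem_filling_iff.1
  mem_filling_not_up := mem_filling_iff.2
  star := exists_src_eq_and_bordering_iff.trans exists_tgt_eq_and_bordering_iff.symm
  sum_coboundary := sum_coboundary
  exists_potential := exists_potential
  const_of_coboundary_eq_zero := const_of_coboundary_eq_zero
  const_on_face K f h := ⟨K f, const_on_face K f h⟩
  const_off_finite := const_off_finite

/-- The position of a site in the plane. -/
def pos (s : ℤ × ℤ) : ℂ := ⟨s.1 + 1, s.2 + 1⟩

/-- The centre of a square. -/
noncomputable def center (f : ℤ × ℤ) : ℂ := ⟨f.1 + 1 / 2, f.2 + 1 / 2⟩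

lemma pos_mem_polygon {e : Edge} {f : ℤ × ℤ} (he : e ∈ bdry f) :
    pos (src e) ∈ quadriculated.polygon f ∧ pos (tgt e) ∈ quadriculated.polygon f := by
  obtain ⟨a, b⟩ := f
  simp only [bdry, Finset.mem_insert, Finset.mem_singleton] at he
  rcases he with rfl | rfl | rfl | rfl <;> simp only [src, tgt] <;> split_ifs <;>
    simp [pos, Complex.mem_reProdIm]

lemma center_notMem_polygon {f f' : ℤ × ℤ} (h : f ≠ f') :
    center f ∉ quadriculated.polygon f' := by
  obtain ⟨a, b⟩ := f
  obtain ⟨a', b'⟩ := f'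
  rintro ⟨⟨h₁, h₂⟩, h₃, h₄⟩
  simp only [center] at h₁ h₂ h₃ h₄
  have ha : (a' : ℝ) < a + 1 ∧ (a : ℝ) < a' + 1 := ⟨by linarith, by linarith⟩
  have hb : (b' : ℝ) < b + 1 ∧ (b : ℝ) < b' + 1 := ⟨by linarith, by linarith⟩
  norm_cast at ha hb
  exact h (Prod.ext (by lia) (by lia))

lemma pos_ne_center (s f : ℤ × ℤ) : pos s ≠ center f := by
  intro h
  have hre : (s.1 : ℝ) + 1 = f.1 + 1 / 2 := congrArg Complex.re h
  field_simp at hre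
  norm_cast at hre
  lia

lemma pos_tgt_sub_center {e : Edge} {f : ℤ × ℤ} (he : e ∈ bdry f) :
    pos (tgt e) - center f =
      (if (f.1 + f.2) % 2 = 0 then Complex.I else -Complex.I) * (pos (src e) - center f) := by
  simp only [bdry, Finset.mem_insert, Finset.mem_singleton] at he
  rcases he with rfl | rfl | rfl | rfl <;> simp only [src, tgt] <;> split_ifs <;>
    first
      | omega
      | apply Complex.ext <;> simp [pos, center]; ring

/-- The drawing of the square tiling. -/
noncomputable def drawing : dualGraph.Drawing where
  pos := pos
  center := center
  convex_polygon f := ((convex_Icc (f.1 : ℝ) (f.1 + 1)).linear_preimage Complex.reLm).inter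
    ((convex_Icc (f.2 : ℝ) (f.2 + 1)).linear_preimage Complex.imLm)
  isClosed_polygon _ := isClosed_Icc.reProdIm isClosed_Icc
  src_mem_polygon he := (pos_mem_polygon he).1
  tgt_mem_polygon he := (pos_mem_polygon he).2
  center_notMem_polygon := center_notMem_polygon
  rotation f := by
    refine ⟨if (f.1 + f.2) % 2 = 0 then Complex.I else -Complex.I, ?_, ?_, fun e he => ?_⟩
    · split_ifs <;> simp
    · split_ifs <;> simp [Complex.ext_iff]
    · refine (congrArg (· / _) (pos_tgt_sub_center he)).trans ?_
      exact mul_div_cancel_right₀ _ (sub_ne_zero.2 (pos_ne_center _ _))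

end Quad

/-! ### The triangular lattice -/

namespace Tri

/-- The edges of the triangular grid: `(i, j, k)` is the `k`-th side of the triangle
`(i, j, true)`. -/
abbrev Edge : Type := ℤ × ℤ × Fin 3

/-- The initial site of an edge; the edges go counterclockwise around the triangles
`(i, j, true)`, which are the black ones. -/
def src : Edge → ℤ × ℤ
  | (i, j, 0) => (i, j)
  | (i, j, 1) => (i + 1, j)
  | (i, j, 2) => (i, j + 1)

/-- The final site of an edge. -/
def tgt : Edge → ℤ × ℤ
  | (i, j, 0) => (i + 1, j)
  | (i, j, 1) => (i, j + 1)
  | (i, j, 2) => (i, j)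

/-- The black triangle along an edge. -/
def left (e : Edge) : ℤ × ℤ × Bool := (e.1, e.2.1, true)

/-- The white triangle along an edge. -/
def right : Edge → ℤ × ℤ × Bool
  | (i, j, 0) => (i, j - 1, false)
  | (i, j, 1) => (i, j, false)
  | (i, j, 2) => (i - 1, j, false)

/-- The three sides of a triangle. -/
def bdry : ℤ × ℤ × Bool → Finset Edge
  | (i, j, true) => {(i, j, 0), (i, j, 1), (i, j, 2)}
  | (i, j, false) => {(i, j + 1, 0), (i, j, 1), (i + 1, j, 2)}

/-- The edges which leave a site. -/
def out (s : ℤ × ℤ) : Finset Edge := {(s.1, s.2, 0), (s.1 - 1, s.2, 1), (s.1, s.2 - 1, 2)}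

/-- The edges which arrive at a site. -/
def inn (s : ℤ × ℤ) : Finset Edge := {(s.1 - 1, s.2, 0), (s.1, s.2 - 1, 1), (s.1, s.2, 2)}

lemma mem_bdry {e : Edge} {f : ℤ × ℤ × Bool} : e ∈ bdry f ↔ left e = f ∨ right e = f := by
  obtain ⟨i, j, k⟩ := e
  obtain ⟨a, b, _ | _⟩ := f <;> fin_cases k <;> grind [bdry, left, right]

lemma mem_out {e : Edge} {s : ℤ × ℤ} : e ∈ out s ↔ src e = s := by
  obtain ⟨i, j, k⟩ := e
  fin_cases k <;> grind [out, src]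

lemma mem_inn {e : Edge} {s : ℤ × ℤ} : e ∈ inn s ↔ tgt e = s := by
  obtain ⟨i, j, k⟩ := e
  fin_cases k <;> grind [inn, tgt]

section Sums

variable {G : Type*}

lemma sum_bdry_true [AddCommMonoid G] (g : Edge → G) (a b : ℤ) :
    ∑ e ∈ bdry (a, b, true), g e = g (a, b, 0) + (g (a, b, 1) + g (a, b, 2)) := by
  rw [bdry, Finset.sum_insert, Finset.sum_insert, Finset.sum_singleton] <;> simp

lemma sum_bdry_false [AddCommMonoid G] (g : Edge → G) (a b : ℤ) :
    ∑ e ∈ bdry (a, b, false), g e = g (a, b + 1, 0) + (g (a, b, 1) + g (a + 1, b, 2)) := by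
  rw [bdry, Finset.sum_insert, Finset.sum_insert, Finset.sum_singleton] <;> simp

lemma card_bdry (f : ℤ × ℤ × Bool) : (bdry f).card = 3 := by
  obtain ⟨a, b, _ | _⟩ := f
  · exact (Finset.card_eq_sum_ones _).trans (sum_bdry_false _ a b)
  · exact (Finset.card_eq_sum_ones _).trans (sum_bdry_true _ a b)

lemma sum_coboundary [AddCommGroup G] (K : ℤ × ℤ → G) (f : ℤ × ℤ × Bool) :
    ∑ e ∈ bdry f, (K (tgt e) - K (src e)) = 0 := by
  obtain ⟨a, b, _ | _⟩ := f
  · rw [sum_bdry_false]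
    simp only [src, tgt]
    abel
  · rw [sum_bdry_true]
    simp only [src, tgt]
    abel

lemma exists_potential [AddCommGroup G] (φ : Edge → G) (hφ : ∀ f, ∑ e ∈ bdry f, φ e = 0) :
    ∃ K : ℤ × ℤ → G, ∀ e, K (tgt e) - K (src e) = φ e := by
  have htrue (i j : ℤ) : φ (i, j, 0) + (φ (i, j, 1) + φ (i, j, 2)) = 0 :=
    (sum_bdry_true φ i j).symm.trans (hφ _)
  have hfalse (i j : ℤ) : φ (i, j + 1, 0) + (φ (i, j, 1) + φ (i + 1, j, 2)) = 0 :=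
    (sum_bdry_false φ i j).symm.trans (hφ _)
  obtain ⟨K, hh, hv⟩ := exists_grid_potential (fun i j => φ (i, j, 0)) (fun i j => -φ (i, j, 2))
    fun i j => by
      rw [← sub_eq_zero, ← sub_eq_zero.2 ((htrue i j).trans (hfalse i j).symm)]
      abel
  refine ⟨K, ?_⟩
  rintro ⟨i, j, k⟩
  fin_cases k
  · exact hh i j
  · change K (i, j + 1) - K (i + 1, j) = φ (i, j, 1)
    rw [← sub_sub_sub_cancel_right _ _ (K (i, j)), hh, hv, ← sub_eq_zero, ← neg_eq_zero,
      ← htrue i j]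
    abel
  · change K (i, j) - K (i, j + 1) = φ (i, j, 2)
    rw [← neg_sub, hv, neg_neg]

end Sums

lemma const_on_face {G : Type*} (K : ℤ × ℤ → G) (f : ℤ × ℤ × Bool)
    (h : ∀ e ∈ bdry f, K (tgt e) = K (src e)) : ∃ k, ∀ e ∈ bdry f, K (src e) = k := by
  obtain ⟨a, b, _ | _⟩ := f <;>
    simp only [bdry, Finset.forall_mem_insert, Finset.mem_singleton, forall_eq, src, tgt] at h ⊢ <;>
    obtain ⟨h₀, h₁, h₂⟩ := h
  · exact ⟨_, rfl, h₁.symm, h₀⟩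
  · exact ⟨_, rfl, h₀, h₂.symm⟩

lemma const_off_finite {G : Type*} (K : ℤ × ℤ → G) (R : Finset (ℤ × ℤ × Bool))
    (h : ∀ e, ¬(left e ∈ R ∧ right e ∈ R) → K (tgt e) = K (src e)) :
    ∃ k, {v | K v ≠ k}.Finite := by
  obtain ⟨N, hN⟩ := (R.image fun f => max |f.1| |f.2.1|).exists_le
  have hfar (e : Edge) (he : N < |e.1| ∨ N < |e.2.1|) : ¬(left e ∈ R ∧ right e ∈ R) := by
    rintro ⟨hl, -⟩
    obtain ⟨h₁, h₂⟩ := max_le_iff.1 (hN _ (Finset.mem_image_of_mem _ hl))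
    exact he.elim h₁.not_gt h₂.not_gt
  exact exists_finite_ne_of_grid_succ_eq_off_box fun i j hij =>
    ⟨h (i, j, 0) (hfar _ hij), (h (i, j, 2) (hfar _ hij)).symm⟩

lemma mem_filling_iff {s : ℤ × ℤ} {d : Finset (ℤ × ℤ × Bool)} :
    (d ∈ triangulated.filling s true ↔ ∃ e, src e = s ∧ d = {left e, right e}) ∧
    (d ∈ triangulated.filling s false ↔ ∃ e, tgt e = s ∧ d = {left e, right e}) := by
  simp only [← mem_out, ← mem_inn, Finset.mem_insert, Finset.mem_singleton, out, inn,
    exists_eq_or_imp, exists_eq_left, left, right]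
  tauto

lemma isTile_iff {d : Finset (ℤ × ℤ × Bool)} :
    triangulated.IsTile d ↔ ∃ e, d = {left e, right e} := by
  constructor
  · rintro ⟨i, j, h | h | h⟩
    · exact ⟨(i, j, 1), h⟩
    · exact ⟨(i, j, 2), h⟩
    · exact ⟨(i, j, 0), h⟩
  · rintro ⟨⟨i, j, k⟩, h⟩
    refine ⟨i, j, ?_⟩
    fin_cases k
    · exact .inr (.inr h)
    · exact .inl h
    · exact .inr (.inl h)

lemma edge_ext {e e' : Edge} (hl : left e = left e') (hr : right e = right e') : e = e' := by
  obtain ⟨i, j, k⟩ := e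
  obtain ⟨i', j', k'⟩ := e'
  fin_cases k <;> fin_cases k' <;> grind [left, right]

lemma exists_src_iff_exists_tgt {v : ℤ × ℤ} {f : ℤ × ℤ × Bool} :
    (∃ e, src e = v ∧ (left e = f ∨ right e = f)) ↔
      ∃ e, tgt e = v ∧ (left e = f ∨ right e = f) := by
  obtain ⟨a, b, k⟩ := f
  simp only [← mem_out, ← mem_inn, Finset.mem_insert, Finset.mem_singleton, out, inn,
    exists_eq_or_imp, exists_eq_left, left, right, Prod.mk.injEq]
  tauto

/-- The dual graph of the triangular tiling. -/
noncomputable def dualGraph : DualGraph triangulated where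
  Edge := Edge
  src := src
  tgt := tgt
  left := left
  right := right
  black f := f.2.2 = true
  deg := 3
  bdry := bdry
  up _ := true
  infinite := inferInstanceAs (Infinite (ℤ × ℤ))
  deg_pos := by norm_num
  black_left _ := rfl
  not_black_right := by
    rintro ⟨i, j, k⟩
    fin_cases k <;> exact Bool.false_ne_true
  mem_bdry := mem_bdry
  card_bdry := card_bdry
  src_surjective s := ⟨(s.1, s.2, 0), rfl⟩
  src_ne_tgt := by
    rintro ⟨i, j, k⟩
    fin_cases k <;> simp [src, tgt]
  edge_ext := edge_ext
  isTile_iff := isTile_iff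
  mem_filling_up := mem_filling_iff.1
  mem_filling_not_up := mem_filling_iff.2
  star := exists_src_iff_exists_tgt
  sum_coboundary := sum_coboundary
  exists_potential := exists_potential
  const_of_coboundary_eq_zero _ h :=
    eq_of_grid_succ_eq (fun i j => h (i, j, 0)) (fun i j => (h (i, j, 2)).symm)
  const_on_face := const_on_face
  const_off_finite := const_off_finite

/-- The position of a site in the plane. -/
noncomputable def pos (s : ℤ × ℤ) : ℂ := oblique (s.1, s.2)

/-- The centre of a triangle. -/
noncomputable def center : ℤ × ℤ × Bool → ℂ
  | (i, j, true) => oblique (i + 1 / 3, j + 1 / 3)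
  | (i, j, false) => oblique (i + 2 / 3, j + 2 / 3)

/-- The oblique coordinates of a point of the plane, inverse to `oblique`. -/
noncomputable def coords (z : ℂ) : ℝ × ℝ := (z.re - z.im / √3, 2 * z.im / √3)

lemma coords_oblique (p : ℝ × ℝ) : coords (oblique p) = p := by
  have : √3 ≠ 0 := by positivity
  ext <;> simp only [coords, oblique, Complex.add_re, Complex.add_im, Complex.ofReal_re,
    Complex.ofReal_im, Complex.re_ofReal_mul, Complex.im_ofReal_mul] <;> field_simp <;> ring

lemma oblique_coords (z : ℂ) : oblique (coords z) = z := by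
  have : √3 ≠ 0 := by positivity
  apply Complex.ext <;> simp only [coords, oblique, Complex.add_re, Complex.add_im,
    Complex.ofReal_re, Complex.ofReal_im, Complex.re_ofReal_mul, Complex.im_ofReal_mul] <;>
    field_simp <;> ring

lemma oblique_image (S : Set (ℝ × ℝ)) : oblique '' S = coords ⁻¹' S :=
  congrFun (Set.image_eq_preimage_of_inverse coords_oblique oblique_coords) S

lemma isLinearMap_oblique : IsLinearMap ℝ oblique where
  map_add p q := by
    simp only [oblique, Prod.fst_add, Prod.snd_add]
    push_cast
    ring
  map_smul c p := by
    simp only [oblique, Prod.smul_fst, Prod.smul_snd, smul_eq_mul, Complex.real_smul]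
    push_cast
    ring

lemma convex_polygon (f : ℤ × ℤ × Bool) : Convex ℝ (triangulated.polygon f) := by
  obtain ⟨i, j, _ | _⟩ := f <;> refine Convex.is_linear_image ?_ isLinearMap_oblique <;>
    refine .inter ?_ (.inter ?_ ?_)
  · exact convex_halfSpace_le (LinearMap.fst ℝ ℝ ℝ).isLinear _
  · exact convex_halfSpace_le (LinearMap.snd ℝ ℝ ℝ).isLinear _
  · exact convex_halfSpace_ge (LinearMap.fst ℝ ℝ ℝ + LinearMap.snd ℝ ℝ ℝ).isLinear _
  · exact convex_halfSpace_ge (LinearMap.fst ℝ ℝ ℝ).isLinear _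
  · exact convex_halfSpace_ge (LinearMap.snd ℝ ℝ ℝ).isLinear _
  · exact convex_halfSpace_le (LinearMap.fst ℝ ℝ ℝ + LinearMap.snd ℝ ℝ ℝ).isLinear _

lemma isClosed_polygon (f : ℤ × ℤ × Bool) : IsClosed (triangulated.polygon f) := by
  have hcoords : Continuous coords := by
    unfold coords
    fun_prop
  obtain ⟨i, j, _ | _⟩ := f <;>
    change IsClosed (oblique '' _) <;> rw [oblique_image] <;>
    refine IsClosed.preimage hcoords (.inter ?_ (.inter ?_ ?_))
  · exact isClosed_le continuous_fst continuous_const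
  · exact isClosed_le continuous_snd continuous_const
  · exact isClosed_le continuous_const (continuous_fst.add continuous_snd)
  · exact isClosed_le continuous_const continuous_fst
  · exact isClosed_le continuous_const continuous_snd
  · exact isClosed_le (continuous_fst.add continuous_snd) continuous_const

lemma pos_mem_polygon {e : Edge} {f : ℤ × ℤ × Bool} (he : e ∈ bdry f) :
    pos (src e) ∈ triangulated.polygon f ∧ pos (tgt e) ∈ triangulated.polygon f := by
  obtain ⟨a, b, _ | _⟩ := f <;> simp only [bdry, Finset.mem_insert, Finset.mem_singleton] at he <;>
    rcases he with rfl | rfl | rfl <;> simp only [src, tgt] <;>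
    constructor <;> refine Set.mem_image_of_mem _ ⟨?_, ?_, ?_⟩ <;> push_cast <;> linarith

lemma center_notMem_polygon {f f' : ℤ × ℤ × Bool} (h : f ≠ f') :
    center f ∉ triangulated.polygon f' := by
  obtain ⟨a, b, _ | _⟩ := f <;> obtain ⟨a', b', _ | _⟩ := f' <;> intro hmem <;>
    change _ ∈ oblique '' _ at hmem <;> rw [oblique_image] at hmem <;>
    simp only [center, Set.mem_preimage, coords_oblique, Set.mem_ofPred_eq] at hmem <;>
    obtain ⟨h₁, h₂, h₃⟩ := hmem <;> field_simp at h₁ h₂ h₃ <;> norm_cast at h₁ h₂ h₃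
  · grind
  · grind
  · grind
  · grind

lemma pos_ne_center (s : ℤ × ℤ) (f : ℤ × ℤ × Bool) : pos s ≠ center f := by
  intro h
  have hcoords := congrArg (fun z => (coords z).1) h
  obtain ⟨a, b, _ | _⟩ := f <;> simp only [pos, center, coords_oblique] at hcoords <;>
    field_simp at hcoords <;> norm_cast at hcoords <;> lia

/-- The rotation by 120° around a triangle, counterclockwise for the black triangles. -/
noncomputable def turn (f : ℤ × ℤ × Bool) : ℂ :=
  if f.2.2 then ⟨-1 / 2, √3 / 2⟩ else ⟨-1 / 2, -√3 / 2⟩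

lemma pos_tgt_sub_center {e : Edge} {f : ℤ × ℤ × Bool} (he : e ∈ bdry f) :
    pos (tgt e) - center f = turn f * (pos (src e) - center f) := by
  have hs : √3 * √3 = 3 := Real.mul_self_sqrt (by norm_num)
  obtain ⟨a, b, _ | _⟩ := f <;> simp only [bdry, Finset.mem_insert, Finset.mem_singleton] at he <;>
    rcases he with rfl | rfl | rfl <;> apply Complex.ext <;>
    simp [src, tgt, pos, center, turn, oblique] <;> grind

/-- The drawing of the triangular tiling. -/
noncomputable def drawing : dualGraph.Drawing where
  pos := pos
  center := center
  convex_polygon := convex_polygon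
  isClosed_polygon := isClosed_polygon
  src_mem_polygon he := (pos_mem_polygon he).1
  tgt_mem_polygon he := (pos_mem_polygon he).2
  center_notMem_polygon := center_notMem_polygon
  rotation f := by
    refine ⟨turn f, ?_, ?_, fun e he => ?_⟩
    · unfold turn
      split_ifs <;> simp [Complex.ext_iff]
    · unfold turn
      split_ifs <;> simp [Complex.ext_iff]
    · refine (congrArg (· / _) (pos_tgt_sub_center he)).trans ?_
      exact mul_div_cancel_right₀ _ (sub_ne_zero.2 (pos_ne_center _ _))

end Tri

/-- The dual graph of a lattice. -/
noncomputable def Lattice.dualGraph : ∀ Λ : Lattice, DualGraph Λ.system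
  | .quad => Quad.dualGraph
  | .tri => Tri.dualGraph

/-- The standard drawing of the dual graph of a lattice. -/
noncomputable def Lattice.drawing : ∀ Λ : Lattice, Λ.dualGraph.Drawing
  | .quad => Quad.drawing
  | .tri => Tri.drawing

namespace DualGraph

variable {L : TileSystem} (M : DualGraph L) {R : Finset L.Face}

/-- The tile formed by the two faces along an edge. -/
def tile (e : M.Edge) : Finset L.Face := {M.left e, M.right e}

/-- A vertex is interior to `R` if all faces around it belong to `R`. -/
def Interior (R : Finset L.Face) (v : L.Site) : Prop :=
  ∀ e, M.src e = v ∨ M.tgt e = v → M.left e ∈ R ∧ M.right e ∈ R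

/-- The indicator function, on the edges, of the tiles of a tiling. -/
def ind (t : Tiling L R) (e : M.Edge) : ℤ := if M.tile e ∈ t.tiles then 1 else 0

open Classical in
/-- The sign of the colour of a face, with which each edge occurs in a coboundary. -/
noncomputable def sign (f : L.Face) : ℂ := if M.black f then 1 else -1

variable {M}

lemma mem_tile {e : M.Edge} {f : L.Face} : f ∈ M.tile e ↔ M.left e = f ∨ M.right e = f := by
  simp [tile, eq_comm]

lemma left_mem_tile (e : M.Edge) : M.left e ∈ M.tile e := mem_tile.2 (.inl rfl)

lemma right_mem_tile (e : M.Edge) : M.right e ∈ M.tile e := mem_tile.2 (.inr rfl)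

lemma mem_bdry_iff_mem_tile {e : M.Edge} {f : L.Face} : e ∈ M.bdry f ↔ f ∈ M.tile e :=
  M.mem_bdry.trans mem_tile.symm

lemma mem_bdry_left (e : M.Edge) : e ∈ M.bdry (M.left e) := M.mem_bdry.2 (.inl rfl)

lemma mem_bdry_right (e : M.Edge) : e ∈ M.bdry (M.right e) := M.mem_bdry.2 (.inr rfl)

lemma left_ne_right (e e' : M.Edge) : M.left e ≠ M.right e' :=
  fun h => M.not_black_right e' (h ▸ M.black_left e)

lemma tile_injective : Function.Injective M.tile := by
  intro e e' h
  refine M.edge_ext ?_ ?_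
  · exact ((mem_tile.1 (h ▸ left_mem_tile e)).resolve_right (left_ne_right _ _).symm).symm
  · exact ((mem_tile.1 (h ▸ right_mem_tile e)).resolve_left (left_ne_right _ _)).symm

lemma exists_tile_eq (t : Tiling L R) {d : Finset L.Face} (hd : d ∈ t.tiles) :
    ∃ e, d = M.tile e := M.isTile_iff.1 (t.isTile d hd)

lemma eq_of_common_face (t : Tiling L R) {e e' : M.Edge} (he : M.tile e ∈ t.tiles)
    (he' : M.tile e' ∈ t.tiles) {f : L.Face} (hf : f ∈ M.tile e) (hf' : f ∈ M.tile e') : e = e' :=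
  tile_injective ((t.cover f (t.subset _ he hf)).unique ⟨he, hf⟩ ⟨he', hf'⟩)

lemma ind_eq_one_iff {t : Tiling L R} {e : M.Edge} : M.ind t e = 1 ↔ M.tile e ∈ t.tiles := by
  simp [ind]

lemma ind_eq_zero_iff {t : Tiling L R} {e : M.Edge} : M.ind t e = 0 ↔ M.tile e ∉ t.tiles := by
  simp [ind]

lemma ind_eq_zero_or_one (t : Tiling L R) (e : M.Edge) : M.ind t e = 0 ∨ M.ind t e = 1 := by
  unfold ind
  split_ifs <;> simp

lemma ind_eq_zero_of_notMem (t : Tiling L R) {e : M.Edge}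
    (he : ¬(M.left e ∈ R ∧ M.right e ∈ R)) : M.ind t e = 0 :=
  ind_eq_zero_iff.2 fun h =>
    he ⟨t.subset _ h (left_mem_tile e), t.subset _ h (right_mem_tile e)⟩

lemma left_and_right_mem_iff {e : M.Edge} :
    (M.left e ∈ R ∧ M.right e ∈ R) ↔ ∀ f, e ∈ M.bdry f → f ∈ R := by
  simp [M.mem_bdry, or_imp, forall_and]

lemma sum_ind (t : Tiling L R) (f : L.Face) :
    ∑ e ∈ M.bdry f, M.ind t e = if f ∈ R then 1 else 0 := by
  split_ifs with hf
  · obtain ⟨d, ⟨hd, hfd⟩, -⟩ := t.cover f hf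
    obtain ⟨e, rfl⟩ := exists_tile_eq (M := M) t hd
    rw [Finset.sum_eq_single e, ind_eq_one_iff.2 hd]
    · exact fun e' he' hne => ind_eq_zero_iff.2 fun h =>
        hne (eq_of_common_face t h hd (mem_bdry_iff_mem_tile.1 he') hfd)
    · exact fun h => absurd (mem_bdry_iff_mem_tile.2 hfd) h
  · exact Finset.sum_eq_zero fun e he => ind_eq_zero_of_notMem t fun h =>
      hf (left_and_right_mem_iff.1 h f he)

lemma ext_ind {t t' : Tiling L R} (h : ∀ e, M.ind t e = M.ind t' e) : t = t' := by
  have tiles_subset {t t' : Tiling L R} (h : ∀ e, M.ind t e = M.ind t' e) :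
      t.tiles ⊆ t'.tiles := fun d hd => by
    obtain ⟨e, rfl⟩ := exists_tile_eq (M := M) t hd
    exact ind_eq_one_iff.1 (h e ▸ ind_eq_one_iff.2 hd)
  exact Tiling.ext ((tiles_subset h).antisymm (tiles_subset fun e => (h e).symm))

lemma finite_interior (M : DualGraph L) (R : Finset L.Face) : {v | M.Interior R v}.Finite := by
  classical
  refine ((R.biUnion M.bdry).image M.src).finite_toSet.subset fun v hv => ?_
  obtain ⟨e, rfl⟩ := M.src_surjective v
  exact Finset.mem_image_of_mem _
    (Finset.mem_biUnion.2 ⟨_, (hv e (.inl rfl)).1, mem_bdry_left e⟩)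

lemma exists_not_interior (M : DualGraph L) (R : Finset L.Face) : ∃ v, ¬M.Interior R v := by
  have := M.infinite
  by_contra! h
  exact Set.infinite_univ ((M.finite_interior R).subset fun v _ => h v)

lemma tile_mem_filling_up {s : L.Site} {e : M.Edge} :
    M.tile e ∈ L.filling s (M.up s) ↔ M.src e = s := by
  rw [M.mem_filling_up]
  exact ⟨fun ⟨e', h, h'⟩ => tile_injective (M := M) h' ▸ h, fun h => ⟨e, h, rfl⟩⟩

lemma tile_mem_filling_not_up {s : L.Site} {e : M.Edge} :
    M.tile e ∈ L.filling s (!M.up s) ↔ M.tgt e = s := by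
  rw [M.mem_filling_not_up]
  exact ⟨fun ⟨e', h, h'⟩ => tile_injective (M := M) h' ▸ h, fun h => ⟨e, h, rfl⟩⟩

lemma eq_up_or_eq_not_up (M : DualGraph L) (s : L.Site) (b : Bool) :
    b = M.up s ∨ b = !M.up s := by
  cases b <;> cases M.up s <;> simp

lemma exists_tile_of_mem_filling (M : DualGraph L) {s : L.Site} {b : Bool} {d : Finset L.Face}
    (hd : d ∈ L.filling s b) : ∃ e, d = M.tile e := by
  rcases M.eq_up_or_eq_not_up s b with rfl | rfl
  · exact (M.mem_filling_up.1 hd).imp fun _ h => h.2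
  · exact (M.mem_filling_not_up.1 hd).imp fun _ h => h.2

lemma notMem_filling_not {s : L.Site} {b : Bool} {e : M.Edge} (he : M.tile e ∈ L.filling s b) :
    M.tile e ∉ L.filling s (!b) := by
  intro he'
  rcases M.eq_up_or_eq_not_up s b with rfl | rfl
  · exact M.src_ne_tgt e ((tile_mem_filling_up.1 he).trans (tile_mem_filling_not_up.1 he').symm)
  · rw [Bool.not_not] at he'
    exact M.src_ne_tgt e ((tile_mem_filling_up.1 he').trans (tile_mem_filling_not_up.1 he).symm)

lemma exists_mem_filling_not_iff {s : L.Site} {b : Bool} {f : L.Face} :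
    (∃ e, M.tile e ∈ L.filling s (!b) ∧ f ∈ M.tile e) ↔
      ∃ e, M.tile e ∈ L.filling s b ∧ f ∈ M.tile e := by
  rcases M.eq_up_or_eq_not_up s b with rfl | rfl
  · simp only [tile_mem_filling_up, tile_mem_filling_not_up, mem_tile, M.star]
  · simp only [Bool.not_not, tile_mem_filling_up, tile_mem_filling_not_up, mem_tile, M.star]

lemma mem_support (b : Bool) {s : L.Site} {f : L.Face} :
    f ∈ support L s ↔ ∃ e, M.tile e ∈ L.filling s b ∧ f ∈ M.tile e := by
  have h : f ∈ support L s ↔ ∃ e, M.tile e ∈ L.filling s false ∧ f ∈ M.tile e := by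
    simp only [support, Finset.mem_biUnion, id]
    constructor
    · rintro ⟨d, hd, hf⟩
      obtain ⟨e, rfl⟩ := M.exists_tile_of_mem_filling hd
      exact ⟨e, hd, hf⟩
    · rintro ⟨e, he, hf⟩
      exact ⟨_, he, hf⟩
  cases b
  · exact h
  · exact h.trans exists_mem_filling_not_iff.symm

lemma mem_support_src {e : M.Edge} {f : L.Face} (hf : f ∈ M.tile e) : f ∈ support L (M.src e) :=
  (mem_support _).2 ⟨e, tile_mem_filling_up.2 rfl, hf⟩

lemma mem_support_tgt {e : M.Edge} {f : L.Face} (hf : f ∈ M.tile e) : f ∈ support L (M.tgt e) :=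
  (mem_support _).2 ⟨e, tile_mem_filling_not_up.2 rfl, hf⟩

lemma interior_of_support_subset {s : L.Site} (hs : support L s ⊆ R) : M.Interior R s := by
  rintro e (rfl | rfl)
  · exact ⟨hs (mem_support_src (left_mem_tile e)), hs (mem_support_src (right_mem_tile e))⟩
  · exact ⟨hs (mem_support_tgt (left_mem_tile e)), hs (mem_support_tgt (right_mem_tile e))⟩

lemma sum_sign_mul_sum_bdry_eq_zero (H : Finset L.Face) (w : M.Edge → ℂ)
    (hw : ∀ e, (M.left e ∈ H ↔ M.right e ∈ H) ∨ w e = 0) :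
    ∑ f ∈ H, M.sign f * ∑ e ∈ M.bdry f, w e = 0 := by
  classical
  have hface : ∀ f ∈ H, M.sign f * ∑ e ∈ M.bdry f, w e = ∑ e ∈ H.biUnion M.bdry,
      ((if M.left e = f then w e else 0) - (if M.right e = f then w e else 0)) := by
    intro f hf
    rw [Finset.mul_sum]
    refine Finset.sum_subset_zero_on_sdiff (Finset.subset_biUnion_of_mem M.bdry hf)
      (fun e he => ?_) (fun e he => ?_)
    · obtain ⟨hl, hr⟩ := not_or.1 (M.mem_bdry.not.1 (Finset.mem_sdiff.1 he).2)
      rw [if_neg hl, if_neg hr, sub_zero]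
    · rcases M.mem_bdry.1 he with rfl | rfl
      · simp [sign, M.black_left, (left_ne_right e e).symm]
      · simp [sign, M.not_black_right, left_ne_right e e]
  rw [Finset.sum_congr rfl hface, Finset.sum_comm]
  refine Finset.sum_eq_zero fun e _ => ?_
  rw [Finset.sum_sub_distrib, Finset.sum_ite_eq, Finset.sum_ite_eq]
  rcases hw e with h | h <;> simp [h]

lemma exists_finset_faces_ne (K : L.Site → ℤ)
    (hK : ∀ e, ¬(M.left e ∈ R ∧ M.right e ∈ R) → K (M.tgt e) = K (M.src e)) :
    ∃ (k : ℤ) (H : Finset L.Face), Disjoint H R ∧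
      ∀ f ∉ R, ∀ e ∈ M.bdry f, (f ∈ H ↔ K (M.src e) ≠ k) := by
  obtain ⟨k, hk⟩ := M.const_off_finite K R hK
  have hfin : {f | f ∉ R ∧ ∃ e ∈ M.bdry f, K (M.src e) ≠ k}.Finite := by
    refine (hk.biUnion fun v _ => (support L v).finite_toSet).subset ?_
    rintro f ⟨-, e, he, hek⟩
    exact Set.mem_biUnion hek (mem_support_src (mem_bdry_iff_mem_tile.1 he))
  refine ⟨k, hfin.toFinset, Finset.disjoint_left.2 fun f hf => (hfin.mem_toFinset.1 hf).1,
    fun f hf e he => ?_⟩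
  obtain ⟨c, hc⟩ := M.const_on_face K f fun e he =>
    hK e fun h => hf (left_and_right_mem_iff.1 h f he)
  rw [hfin.mem_toFinset, hc e he]
  exact ⟨fun ⟨_, e', he', h⟩ => hc e' he' ▸ h, fun h => ⟨hf, e, he, (hc e he).symm ▸ h⟩⟩

/-- If `K` took another value than its value at infinity around a face `f₀`, then a cochain
winding around `f₀` only would contradict `sum_sign_mul_sum_bdry_eq_zero`, applied to the faces
around which `K` is not its value at infinity. -/
theorem NoHoles.const_of_locally_const (hR : M.NoHoles R) (K : L.Site → ℤ)
    (hK : ∀ e, ¬(M.left e ∈ R ∧ M.right e ∈ R) → K (M.tgt e) = K (M.src e)) :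
    ∃ k, ∀ v, ¬M.Interior R v → K v = k := by
  obtain ⟨k, H, hHR, hH⟩ := exists_finset_faces_ne K hK
  refine ⟨k, fun v hv => ?_⟩
  by_contra hvk
  obtain ⟨f₀, hf₀⟩ : H.Nonempty := by
    obtain ⟨e, hev, he⟩ : ∃ e, (M.src e = v ∨ M.tgt e = v) ∧ ¬(M.left e ∈ R ∧ M.right e ∈ R) := by
      simpa only [Interior, not_forall, exists_prop] using hv
    have hne : K (M.src e) ≠ k := by
      rcases hev with rfl | rfl
      · exact hvk
      · rwa [← hK e he]
    obtain ⟨f, he, hf⟩ : ∃ f, e ∈ M.bdry f ∧ f ∉ R := by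
      simpa only [not_forall, exists_prop] using left_and_right_mem_iff.not.1 he
    exact ⟨f, (hH f hf e he).2 hne⟩
  obtain ⟨w, hw, hcurl⟩ := hR f₀ (Finset.disjoint_left.1 hHR hf₀)
  have hsign : ∑ f ∈ H, M.sign f * ∑ e ∈ M.bdry f, w e = M.sign f₀ := by
    simp only [hcurl, mul_ite, mul_one, mul_zero, Finset.sum_ite_eq', if_pos hf₀]
  refine (?_ : M.sign f₀ ≠ 0) (hsign.symm.trans (sum_sign_mul_sum_bdry_eq_zero H w fun e => ?_))
  · unfold sign
    split_ifs <;> simp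
  · by_cases he : M.left e ∈ R ∨ M.right e ∈ R
    · exact .inr (hw e he)
    · obtain ⟨hl, hr⟩ := not_or.1 he
      exact .inl ((hH _ hl e (mem_bdry_left e)).trans (hH _ hr e (mem_bdry_right e)).symm)

theorem NoHoles.exists_potential (hR : M.NoHoles R) (c : M.Edge → ℂ)
    (hc : ∀ f ∈ R, ∑ e ∈ M.bdry f, c e = 0) : ∃ K : L.Site → ℂ,
      ∀ e, M.left e ∈ R ∨ M.right e ∈ R → K (M.tgt e) - K (M.src e) = c e := by
  classical
  choose! w hw hcurl using hR
  set c' : M.Edge → ℂ := fun e => if M.left e ∈ R ∨ M.right e ∈ R then c e else 0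
  set F : Finset L.Face := (R.biUnion M.bdry).biUnion M.tile \ R
  have hF_notMem {f : L.Face} (hf : f ∈ F) : f ∉ R := (Finset.mem_sdiff.1 hf).2
  have hmemR {f : L.Face} {e : M.Edge} (hf : f ∈ R) (he : e ∈ M.bdry f) :
      M.left e ∈ R ∨ M.right e ∈ R := by
    rcases M.mem_bdry.1 he with rfl | rfl
    exacts [.inl hf, .inr hf]
  have hsum (f : L.Face) (hf : f ∉ F) : ∑ e ∈ M.bdry f, c' e = 0 := by
    by_cases hfR : f ∈ R
    · exact (Finset.sum_congr rfl fun e he => if_pos (hmemR hfR he)).trans (hc f hfR)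
    · refine Finset.sum_eq_zero fun e he => if_neg fun h => hf ?_
      obtain ⟨f', hf', he'⟩ : ∃ f' ∈ R, e ∈ M.bdry f' :=
        h.elim (fun h => ⟨_, h, mem_bdry_left e⟩) fun h => ⟨_, h, mem_bdry_right e⟩
      exact Finset.mem_sdiff.2 ⟨Finset.mem_biUnion.2 ⟨e, Finset.mem_biUnion.2 ⟨f', hf', he'⟩,
        mem_bdry_iff_mem_tile.1 he⟩, hfR⟩
  obtain ⟨K, hK⟩ := M.exists_potential
    (fun e => c' e - ∑ f ∈ F, (∑ e' ∈ M.bdry f, c' e') * w f e) fun f => by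
      have hwind : ∀ f' ∈ F, ∑ e ∈ M.bdry f, (∑ e' ∈ M.bdry f', c' e') * w f' e =
          if f = f' then ∑ e' ∈ M.bdry f', c' e' else 0 := fun f' hf' => by
        rw [← Finset.mul_sum, hcurl f' (hF_notMem hf'), mul_ite, mul_one, mul_zero]
      rw [Finset.sum_sub_distrib, Finset.sum_comm, Finset.sum_congr rfl hwind,
        Finset.sum_ite_eq]
      split_ifs with hf
      · exact sub_self _
      · rw [hsum f hf, sub_zero]
  refine ⟨K, fun e he => ?_⟩
  rw [hK, Finset.sum_eq_zero fun f hf => by rw [hw f (hF_notMem hf) e he, mul_zero], sub_zero]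
  exact if_pos he

end DualGraph

/-! ### Height functions -/

/-- `t'` is obtained from `t` by replacing the filling `b` of the site `s` by the other one. -/
def IsFlipAt {L : TileSystem} {R : Finset L.Face} (s : L.Site) (b : Bool) (t t' : Tiling L R) :
    Prop :=
  L.filling s b ⊆ t.tiles ∧ t'.tiles = (t.tiles \ L.filling s b) ∪ L.filling s (!b)

namespace DualGraph

variable {L : TileSystem} {M : DualGraph L} {R : Finset L.Face}

theorem NoHoles.exists_height (hR : M.NoHoles R) (t₀ t : Tiling L R) :
    ∃ h : L.Site → ℤ, (∀ v, ¬M.Interior R v → h v = 0) ∧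
      ∀ e, h (M.tgt e) - h (M.src e) = M.ind t e - M.ind t₀ e := by
  obtain ⟨K, hK⟩ := M.exists_potential (fun e => M.ind t e - M.ind t₀ e) fun f => by
    rw [Finset.sum_sub_distrib, sum_ind, sum_ind, sub_self]
  obtain ⟨k, hk⟩ := hR.const_of_locally_const K fun e he => by
    rw [← sub_eq_zero, hK, ind_eq_zero_of_notMem t he, ind_eq_zero_of_notMem t₀ he, sub_self]
  refine ⟨fun v => K v - k, fun v hv => sub_eq_zero.2 (hk v hv), fun e => ?_⟩
  rw [sub_sub_sub_cancel_right, hK]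

/-- The height function of the tiling `t`, relative to the tiling `t₀`. -/
noncomputable def height (hR : M.NoHoles R) (t₀ t : Tiling L R) : L.Site → ℤ :=
  (hR.exists_height t₀ t).choose

/-- The functions on the vertices which are height functions of tilings, relative to `t₀`. -/
def IsHeight (M : DualGraph L) (t₀ : Tiling L R) (h : L.Site → ℤ) : Prop :=
  (∀ v, ¬M.Interior R v → h v = 0) ∧
    ∀ e, M.ind t₀ e + (h (M.tgt e) - h (M.src e)) = 0 ∨
      M.ind t₀ e + (h (M.tgt e) - h (M.src e)) = 1

/-- The change of the height at `s` when the filling `b` of `s` is replaced by the other one. -/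
def flipSign (M : DualGraph L) (s : L.Site) (b : Bool) : ℤ := if b = M.up s then 1 else -1

variable {hR : M.NoHoles R} {t₀ t t' : Tiling L R} {s : L.Site} {b : Bool}

lemma height_eq_zero (t : Tiling L R) {v : L.Site} (hv : ¬M.Interior R v) :
    height hR t₀ t v = 0 := (hR.exists_height t₀ t).choose_spec.1 v hv

lemma height_sub (t : Tiling L R) (e : M.Edge) :
    height hR t₀ t (M.tgt e) - height hR t₀ t (M.src e) = M.ind t e - M.ind t₀ e :=
  (hR.exists_height t₀ t).choose_spec.2 e

lemma eq_of_coboundary_eq {h h' : L.Site → ℤ} (h0 : ∀ v, ¬M.Interior R v → h v = 0)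
    (h0' : ∀ v, ¬M.Interior R v → h' v = 0)
    (H : ∀ e, h (M.tgt e) - h (M.src e) = h' (M.tgt e) - h' (M.src e)) : h = h' := by
  obtain ⟨v₀, hv₀⟩ := M.exists_not_interior R
  funext v
  have := M.const_of_coboundary_eq_zero (fun v => h v - h' v) (fun e => by linarith [H e]) v v₀
  simp only [h0 v₀ hv₀, h0' v₀ hv₀] at this
  linarith

lemma height_injective : Function.Injective (height hR t₀) := by
  refine fun t t' h => ext_ind (M := M) fun e => ?_
  have := height_sub (hR := hR) (t₀ := t₀) t e
  rw [h, height_sub] at this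
  linarith

lemma isHeight_height (t : Tiling L R) : M.IsHeight t₀ (height hR t₀ t) := by
  refine ⟨fun v hv => height_eq_zero t hv, fun e => ?_⟩
  rw [height_sub, add_sub_cancel]
  exact ind_eq_zero_or_one t e

theorem exists_ind_eq {g : M.Edge → ℤ} (hg : ∀ e, g e = 0 ∨ g e = 1)
    (hgR : ∀ e, g e = 1 → M.left e ∈ R ∧ M.right e ∈ R)
    (hsum : ∀ f ∈ R, ∑ e ∈ M.bdry f, g e = 1) : ∃ t : Tiling L R, ∀ e, M.ind t e = g e := by
  classical
  set T := ((R.biUnion M.bdry).filter fun e => g e = 1).image M.tile with hT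
  have tile_mem_T (e : M.Edge) : M.tile e ∈ T ↔ g e = 1 := by
    rw [hT, tile_injective.mem_finset_image, Finset.mem_filter, Finset.mem_biUnion,
      and_iff_right_of_imp]
    exact fun h => ⟨_, (hgR e h).1, mem_bdry_left e⟩
  have eq_tile_of_mem_T {d : Finset L.Face} (hd : d ∈ T) : ∃ e, d = M.tile e :=
    (Finset.mem_image.1 hd).imp fun e he => he.2.symm
  refine ⟨⟨T, fun d hd => M.isTile_iff.2 (eq_tile_of_mem_T hd), fun d hd f hf => ?_,
    fun f hf => ?_⟩, fun e => ?_⟩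
  · obtain ⟨e, rfl⟩ := eq_tile_of_mem_T hd
    exact left_and_right_mem_iff.1 (hgR e ((tile_mem_T e).1 hd)) f (mem_bdry_iff_mem_tile.2 hf)
  · have hcard : (((M.bdry f).filter fun e => g e = 1).card : ℤ) = 1 := by
      refine Eq.trans ?_ (hsum f hf)
      rw [Finset.natCast_card_filter]
      refine Finset.sum_congr rfl fun e _ => ?_
      rcases hg e with h | h <;> simp [h]
    obtain ⟨e, he⟩ := Finset.card_eq_one.1 (by exact_mod_cast hcard)
    have unique_edge (e' : M.Edge) : (e' ∈ M.bdry f ∧ g e' = 1) ↔ e' = e := by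
      simpa using Finset.ext_iff.1 he e'
    obtain ⟨hef, hge⟩ := (unique_edge e).2 rfl
    refine ⟨M.tile e, ⟨(tile_mem_T e).2 hge, mem_bdry_iff_mem_tile.1 hef⟩, ?_⟩
    rintro d ⟨hd, hfd⟩
    obtain ⟨e', rfl⟩ := eq_tile_of_mem_T hd
    rw [(unique_edge e').1 ⟨mem_bdry_iff_mem_tile.2 hfd, (tile_mem_T e').1 hd⟩]
  · rcases hg e with h | h <;> simp [ind, tile_mem_T, h]

theorem IsHeight.exists_tiling {h : L.Site → ℤ} (hh : M.IsHeight t₀ h) :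
    ∃ t : Tiling L R, ∀ e, M.ind t e = M.ind t₀ e + (h (M.tgt e) - h (M.src e)) := by
  refine exists_ind_eq hh.2 (fun e he => ?_) fun f hf => ?_
  · by_contra hc
    rw [hh.1 _ fun hi => hc (hi e (.inr rfl)), hh.1 _ fun hi => hc (hi e (.inl rfl)),
      ind_eq_zero_of_notMem t₀ hc] at he
    simp at he
  · rw [Finset.sum_add_distrib, M.sum_coboundary, sum_ind, if_pos hf, add_zero]

theorem IsHeight.exists_height_eq (hR : M.NoHoles R) {h : L.Site → ℤ} (hh : M.IsHeight t₀ h) :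
    ∃ t : Tiling L R, height hR t₀ t = h := by
  obtain ⟨t, ht⟩ := hh.exists_tiling
  refine ⟨t, eq_of_coboundary_eq (fun v => height_eq_zero t) hh.1 fun e => ?_⟩
  rw [height_sub, ht, add_sub_cancel_left]

lemma IsHeight.of_forall_edge {g : L.Site → ℤ} (H : ∀ e, ∃ h, M.IsHeight t₀ h ∧
    h (M.src e) = g (M.src e) ∧ h (M.tgt e) = g (M.tgt e)) : M.IsHeight t₀ g := by
  refine ⟨fun v hv => ?_, fun e => ?_⟩
  · obtain ⟨e, rfl⟩ := M.src_surjective v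
    obtain ⟨h, hh, hsrc, -⟩ := H e
    exact hsrc ▸ hh.1 _ hv
  · obtain ⟨h, hh, hsrc, htgt⟩ := H e
    exact hsrc ▸ htgt ▸ hh.2 e

lemma IsHeight.inf {h h' : L.Site → ℤ} (hh : M.IsHeight t₀ h) (hh' : M.IsHeight t₀ h') :
    M.IsHeight t₀ (h ⊓ h') := by
  refine ⟨fun v hv => by simp [hh.1 v hv, hh'.1 v hv], fun e => ?_⟩
  have := hh.2 e
  have := hh'.2 e
  simp only [Pi.inf_apply]
  omega

lemma IsHeight.sup {h h' : L.Site → ℤ} (hh : M.IsHeight t₀ h) (hh' : M.IsHeight t₀ h') :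
    M.IsHeight t₀ (h ⊔ h') := by
  refine ⟨fun v hv => by simp [hh.1 v hv, hh'.1 v hv], fun e => ?_⟩
  have := hh.2 e
  have := hh'.2 e
  simp only [Pi.sup_apply]
  omega

lemma tile_notMem_of_filling_subset (hb : L.filling s b ⊆ t.tiles) {e : M.Edge}
    (he : M.tile e ∈ L.filling s (!b)) : M.tile e ∉ t.tiles := by
  intro h
  obtain ⟨e', he', hf⟩ := exists_mem_filling_not_iff.1 ⟨e, he, left_mem_tile e⟩
  obtain rfl := eq_of_common_face t h (hb he') (left_mem_tile e) hf
  exact notMem_filling_not he' he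

lemma tiles_eq_iff_ind (hb : L.filling s b ⊆ t.tiles) :
    t'.tiles = (t.tiles \ L.filling s b) ∪ L.filling s (!b) ↔
      ∀ e, M.ind t' e - M.ind t e = (if M.tile e ∈ L.filling s (!b) then 1 else 0) -
        (if M.tile e ∈ L.filling s b then 1 else 0) := by
  have hedge (e : M.Edge) : (M.tile e ∈ t'.tiles ↔
      M.tile e ∈ (t.tiles \ L.filling s b) ∪ L.filling s (!b)) ↔
      M.ind t' e - M.ind t e = (if M.tile e ∈ L.filling s (!b) then 1 else 0) -
        (if M.tile e ∈ L.filling s b then 1 else 0) := by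
    have hnot := tile_notMem_of_filling_subset hb (e := e)
    have hmem : M.tile e ∈ L.filling s b → M.tile e ∈ t.tiles := fun h => hb h
    simp only [ind, Finset.mem_union, Finset.mem_sdiff]
    grind
  simp only [← hedge]
  refine ⟨fun h e => by rw [h], fun h => Finset.ext fun d => ?_⟩
  by_cases hd : ∃ e, d = M.tile e
  · obtain ⟨e, rfl⟩ := hd
    exact h e
  · refine iff_of_false (hd ∘ exists_tile_eq t') fun hmem => hd ?_
    rcases Finset.mem_union.1 hmem with hmem | hmem
    · exact exists_tile_eq t (Finset.mem_sdiff.1 hmem).1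
    · exact M.exists_tile_of_mem_filling hmem

lemma isFlipAt_iff_ind : IsFlipAt s b t t' ↔
    ∀ e, M.ind t' e - M.ind t e = (if M.tile e ∈ L.filling s (!b) then 1 else 0) -
      (if M.tile e ∈ L.filling s b then 1 else 0) := by
  refine ⟨fun h => (tiles_eq_iff_ind h.1).1 h.2, fun h => ?_⟩
  suffices hb : L.filling s b ⊆ t.tiles from ⟨hb, (tiles_eq_iff_ind hb).2 h⟩
  intro d hd
  obtain ⟨e, rfl⟩ := M.exists_tile_of_mem_filling hd
  have he := h e
  rw [if_neg (notMem_filling_not hd), if_pos hd] at he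
  have := ind_eq_zero_or_one t e
  have := ind_eq_zero_or_one t' e
  exact ind_eq_one_iff.1 (by omega)

lemma interior_of_filling_subset (hb : L.filling s b ⊆ t.tiles) : M.Interior R s := by
  refine interior_of_support_subset fun f hf => ?_
  obtain ⟨e, he, hf⟩ := (mem_support (M := M) b).1 hf
  exact t.subset _ (hb he) hf

lemma flipSign_eq_one_or_neg_one (M : DualGraph L) (s : L.Site) (b : Bool) :
    M.flipSign s b = 1 ∨ M.flipSign s b = -1 := by
  unfold flipSign
  split_ifs <;> simp

lemma flipSign_ne_zero (M : DualGraph L) (s : L.Site) (b : Bool) : M.flipSign s b ≠ 0 := by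
  have := M.flipSign_eq_one_or_neg_one s b
  omega

lemma flipSign_up (M : DualGraph L) (s : L.Site) : M.flipSign s (M.up s) = 1 := if_pos rfl

lemma flipSign_not_up (M : DualGraph L) (s : L.Site) : M.flipSign s (!M.up s) = -1 :=
  if_neg (Bool.not_ne_self _)

lemma flipSign_not (M : DualGraph L) (s : L.Site) (b : Bool) :
    M.flipSign s (!b) = -M.flipSign s b := by
  unfold flipSign
  cases b <;> cases M.up s <;> rfl

lemma coboundary_single_flipSign (s : L.Site) (b : Bool) (e : M.Edge) :
    (Pi.single s (M.flipSign s b) : L.Site → ℤ) (M.tgt e) -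
      (Pi.single s (M.flipSign s b) : L.Site → ℤ) (M.src e) =
      (if M.tile e ∈ L.filling s (!b) then 1 else 0) -
        (if M.tile e ∈ L.filling s b then 1 else 0) := by
  rcases M.eq_up_or_eq_not_up s b with rfl | rfl
  · simp only [flipSign_up, Pi.single_apply, tile_mem_filling_up, tile_mem_filling_not_up]
  · simp only [flipSign_not_up, Pi.single_apply, Bool.not_not, tile_mem_filling_up,
      tile_mem_filling_not_up]
    split_ifs <;> rfl

lemma add_single_eq_zero {h : L.Site → ℤ} (h0 : ∀ v, ¬M.Interior R v → h v = 0)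
    (hs : M.Interior R s) (σ : ℤ) (v : L.Site) (hv : ¬M.Interior R v) :
    (h + (Pi.single s σ : L.Site → ℤ)) v = 0 := by
  have hvs : v ≠ s := fun hvs => hv (hvs ▸ hs)
  rw [Pi.add_apply, h0 v hv, Pi.single_eq_of_ne hvs, add_zero]

lemma height_eq_add_single_iff (hs : M.Interior R s) :
    height hR t₀ t' = height hR t₀ t + Pi.single s (M.flipSign s b) ↔ IsFlipAt s b t t' := by
  simp only [isFlipAt_iff_ind (M := M), ← coboundary_single_flipSign]
  refine ⟨fun h e => ?_, fun h => eq_of_coboundary_eq (fun v => height_eq_zero t')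
    (add_single_eq_zero (fun v => height_eq_zero t) hs _) fun e => ?_⟩
  · have := height_sub (hR := hR) (t₀ := t₀) t' e
    rw [h, Pi.add_apply, Pi.add_apply, add_sub_add_comm, height_sub] at this
    linarith
  · rw [Pi.add_apply, Pi.add_apply, add_sub_add_comm, height_sub, height_sub, ← h]
    ring

lemma interior_of_height_eq {σ : ℤ} (hσ : σ ≠ 0)
    (h : height hR t₀ t' = height hR t₀ t + Pi.single s σ) : M.Interior R s := by
  by_contra hs
  have := congrFun h s
  rw [Pi.add_apply, height_eq_zero t' hs, height_eq_zero t hs, Pi.single_eq_same] at this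
  omega

theorem isFlipAt_iff_height : IsFlipAt s b t t' ↔
    height hR t₀ t' = height hR t₀ t + Pi.single s (M.flipSign s b) :=
  ⟨fun h => (height_eq_add_single_iff (interior_of_filling_subset h.1)).2 h,
    fun h => (height_eq_add_single_iff (interior_of_height_eq (M.flipSign_ne_zero s b) h)).1 h⟩

theorem isFlip_iff_height : IsFlip s t t' ↔
    ∃ b, height hR t₀ t' = height hR t₀ t + Pi.single s (M.flipSign s b) :=
  exists_congr fun _ => isFlipAt_iff_height

lemma isFlip_symm (hR : M.NoHoles R) (h : IsFlip s t t') : IsFlip s t' t := by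
  obtain ⟨b, h⟩ := (isFlip_iff_height (hR := hR) (t₀ := t)).1 h
  refine (isFlip_iff_height (hR := hR) (t₀ := t)).2 ⟨!b, ?_⟩
  rw [h, flipSign_not, Pi.single_neg, add_neg_cancel_right]

lemma adj_iff_exists_isFlip (hR : M.NoHoles R) :
    (flipGraph L R).Adj t t' ↔ ∃ s, IsFlip s t t' := by
  rw [flipGraph, SimpleGraph.fromRel_adj]
  refine ⟨fun h => h.2.elim id fun ⟨s, h⟩ => ⟨s, isFlip_symm hR h⟩,
    fun ⟨s, h⟩ => ⟨?_, .inl ⟨s, h⟩⟩⟩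
  rintro rfl
  obtain ⟨b, h⟩ := (isFlip_iff_height (hR := hR) (t₀ := t)).1 h
  exact M.flipSign_ne_zero s b (Pi.single_eq_zero_iff.1 (left_eq_add.1 h))

lemma exists_common_edge {u v : L.Site} {b b' : Bool} (hu : L.filling u b ⊆ t.tiles)
    (hv : L.filling v b' ⊆ t.tiles) (h : ¬Disjoint (support L u) (support L v)) :
    ∃ e, M.tile e ∈ L.filling u b ∧ M.tile e ∈ L.filling v b' := by
  obtain ⟨f, hfu, hfv⟩ := Finset.not_disjoint_iff.1 h
  obtain ⟨e, he, hf⟩ := (mem_support (M := M) b).1 hfu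
  obtain ⟨e', he', hf'⟩ := (mem_support (M := M) b').1 hfv
  obtain rfl := eq_of_common_face t (hu he) (hv he') hf hf'
  exact ⟨e, he, he'⟩

/-- No edge joins two vertices of `S`, so every edge only sees one of the changes. -/
lemma IsHeight.of_pairwiseDisjoint {h g : L.Site → ℤ} {S : Set L.Site} {σ : L.Site → ℤ}
    (hS : S.PairwiseDisjoint (support L)) (hh : M.IsHeight t₀ h)
    (hσ : ∀ s ∈ S, M.IsHeight t₀ (h + Pi.single s (σ s)))
    (hg : ∀ v, g v = h v ∨ v ∈ S ∧ g v = h v + σ v) : M.IsHeight t₀ g := by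
  refine .of_forall_edge fun e => ?_
  have hst := M.src_ne_tgt e
  rcases hg (M.src e) with hsrc | ⟨hsS, hsrc⟩ <;> rcases hg (M.tgt e) with htgt | ⟨htS, htgt⟩
  · exact ⟨h, hh, hsrc.symm, htgt.symm⟩
  · exact ⟨_, hσ _ htS, by simp [hst, hsrc], by simp [htgt]⟩
  · exact ⟨_, hσ _ hsS, by simp [hsrc], by simp [hst.symm, htgt]⟩
  · exact absurd (mem_support_tgt (left_mem_tile e))
      (Finset.disjoint_left.1 (hS hsS htS hst) (mem_support_src (left_mem_tile e)))

lemma filling_up_subset_of_isHeight_add {h : L.Site → ℤ} (ht : height hR t₀ t = h)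
    (h' : M.IsHeight t₀ (h + Pi.single s 1)) : L.filling s (M.up s) ⊆ t.tiles := by
  obtain ⟨t', ht'⟩ := h'.exists_height_eq hR
  refine ((isFlipAt_iff_height (hR := hR) (t₀ := t₀) (t' := t')).2 ?_).1
  rw [flipSign_up, ht', ht]

theorem disjoint_support_of_isHeight_add_one (hR : M.NoHoles R) {h : L.Site → ℤ} {u v : L.Site}
    (hh : M.IsHeight t₀ h) (hu : M.IsHeight t₀ (h + Pi.single u 1))
    (hv : M.IsHeight t₀ (h + Pi.single v 1)) (huv : u ≠ v) :
    Disjoint (support L u) (support L v) := by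
  obtain ⟨t, ht⟩ := hh.exists_height_eq hR
  by_contra hd
  obtain ⟨e, heu, hev⟩ := exists_common_edge (filling_up_subset_of_isHeight_add ht hu)
    (filling_up_subset_of_isHeight_add ht hv) hd
  exact huv ((tile_mem_filling_up.1 heu).symm.trans (tile_mem_filling_up.1 hev))

theorem isHeight_add_of_filling_subset (hb : L.filling s b ⊆ t.tiles) :
    M.IsHeight t₀ (height hR t₀ t + Pi.single s (M.flipSign s b)) := by
  refine ⟨add_single_eq_zero (fun v => height_eq_zero t) (interior_of_filling_subset hb) _,
    fun e => ?_⟩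
  rw [Pi.add_apply, Pi.add_apply, add_sub_add_comm, coboundary_single_flipSign, height_sub,
    ← add_assoc, add_sub_cancel]
  have hnot := tile_notMem_of_filling_subset hb (e := e)
  have hmem : M.tile e ∈ L.filling s b → M.tile e ∈ t.tiles := fun h => hb h
  unfold ind
  grind

/-- By Stokes the coboundary of `P` vanishes around the faces of `R`: each of them has `deg`
sides, one of which is crossed by a tile. -/
theorem NoHoles.exists_potential_tiling (hR : M.NoHoles R) (t : Tiling L R) :
    ∃ P : L.Site → ℝ, ∀ e, M.left e ∈ R ∨ M.right e ∈ R →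
      P (M.tgt e) - P (M.src e) = 1 - M.deg * M.ind t e := by
  obtain ⟨K, hK⟩ := hR.exists_potential (fun e => 1 - M.deg * (M.ind t e : ℂ)) fun f hf => by
    rw [Finset.sum_sub_distrib, ← Finset.mul_sum, ← Int.cast_sum, sum_ind, if_pos hf,
      Finset.sum_const, M.card_bdry]
    simp
  refine ⟨fun v => (K v).re, fun e he => ?_⟩
  rw [← Complex.sub_re, hK e he]
  simp

/-- Among the vertices where `h < h'`, take one which maximises the potential of
`exists_potential_tiling`: the potential increases along an edge not crossed by a tile. -/
theorem exists_isHeight_add_one (hR : M.NoHoles R) {h h' : L.Site → ℤ} (hh : M.IsHeight t₀ h)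
    (hh' : M.IsHeight t₀ h') {v : L.Site} (hv : h v < h' v) :
    ∃ u, h u < h' u ∧ M.IsHeight t₀ (h + Pi.single u 1) := by
  obtain ⟨t, rfl⟩ := hh.exists_height_eq hR
  obtain ⟨P, hP⟩ := hR.exists_potential_tiling t
  have interior_of_lt (u : L.Site) (hu : height hR t₀ t u < h' u) : M.Interior R u := by
    by_contra hc
    rw [hh.1 u hc, hh'.1 u hc] at hu
    exact lt_irrefl _ hu
  obtain ⟨u, hu, hmax⟩ := Set.exists_max_image {u | height hR t₀ t u < h' u} P
    ((M.finite_interior R).subset interior_of_lt) ⟨v, hv⟩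
  have ind_eq_one (e : M.Edge) (he : M.src e = u) : M.ind t e = 1 := by
    subst he
    refine (ind_eq_zero_or_one t e).resolve_left fun hzero => ?_
    have htgt : P (M.tgt e) ≤ P (M.src e) := hmax _ <| by
      have := height_sub (hR := hR) (t₀ := t₀) t e
      have := hh'.2 e
      rw [Set.mem_ofPred_eq] at hu ⊢
      omega
    have hsub := hP e (.inl (interior_of_lt _ hu e (.inl rfl)).1)
    rw [hzero, Int.cast_zero, mul_zero, sub_zero] at hsub
    linarith
  refine ⟨u, hu, M.flipSign_up u ▸ isHeight_add_of_filling_subset fun d hd => ?_⟩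
  obtain ⟨e, rfl⟩ := M.exists_tile_of_mem_filling hd
  exact ind_eq_one_iff.1 (ind_eq_one e (tile_mem_filling_up.1 hd))

end DualGraph

/-! ### Geodesics -/

lemma Swap.cons {L : TileSystem} {R : Finset L.Face} {t u t' : Tiling L R}
    (h : (flipGraph L R).Adj t u) {p q : (flipGraph L R).Walk u t'} (hpq : Swap p q) :
    Swap (.cons h p) (.cons h q) := by
  obtain ⟨a, v, v', c, p₁, p₂, h₁, h₂, h₁', h₂', r, s, hd, f₁, f₂, f₃, f₄, rfl, rfl⟩ := hpq
  exact ⟨a, v, v', c, .cons h p₁, p₂, h₁, h₂, h₁', h₂', r, s, hd, f₁, f₂, f₃, f₄, rfl, rfl⟩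

lemma Equivalent.cons {L : TileSystem} {R : Finset L.Face} {t u t' : Tiling L R}
    (h : (flipGraph L R).Adj t u) {p q : (flipGraph L R).Walk u t'} (hpq : Equivalent p q) :
    Equivalent (.cons h p) (.cons h q) := by
  induction hpq with
  | rel p q hpq => exact .rel _ _ (hpq.cons h)
  | refl p => exact .refl _
  | symm p q _ ih => exact .symm _ _ ih
  | trans p q r _ _ ih₁ ih₂ => exact .trans _ _ _ ih₁ ih₂

namespace DualGraph

variable {L : TileSystem} {M : DualGraph L} {R : Finset L.Face} {hR : M.NoHoles R}

/-- The `ℓ¹` distance of the height functions of two tilings. -/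
noncomputable def heightDist (hR : M.NoHoles R) (t₀ t t' : Tiling L R) : ℕ :=
  ∑ v ∈ (M.finite_interior R).toFinset, (height hR t₀ t v - height hR t₀ t' v).natAbs

variable {t₀ t t' u u' : Tiling L R} {s s' : L.Site} {b b' : Bool}

lemma heightDist_comm (t t' : Tiling L R) : heightDist hR t₀ t t' = heightDist hR t₀ t' t :=
  Finset.sum_congr rfl fun _ _ => by rw [← Int.natAbs_neg, neg_sub]

lemma eq_of_heightDist_eq_zero (h : heightDist hR t₀ t t' = 0) : t = t' := by
  refine height_injective (hR := hR) (t₀ := t₀) (funext fun v => ?_)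
  by_cases hv : M.Interior R v
  · have := Finset.sum_eq_zero_iff.1 h v ((M.finite_interior R).mem_toFinset.2 hv)
    omega
  · rw [height_eq_zero t hv, height_eq_zero t' hv]

lemma heightDist_add_single {σ : ℤ} (hσ : σ ≠ 0)
    (h : height hR t₀ u = height hR t₀ t + Pi.single s σ) :
    heightDist hR t₀ t t' + (height hR t₀ t s + σ - height hR t₀ t' s).natAbs =
      heightDist hR t₀ u t' + (height hR t₀ t s - height hR t₀ t' s).natAbs := by
  classical
  have hs : s ∈ (M.finite_interior R).toFinset :=
    (M.finite_interior R).mem_toFinset.2 (interior_of_height_eq hσ h)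
  have hus : height hR t₀ u s = height hR t₀ t s + σ := by
    rw [h, Pi.add_apply, Pi.single_eq_same]
  have huv (v : L.Site) (hv : v ≠ s) : height hR t₀ u v = height hR t₀ t v := by
    rw [h, Pi.add_apply, Pi.single_eq_of_ne hv, add_zero]
  unfold heightDist
  rw [← Finset.add_sum_erase _ _ hs, ← Finset.add_sum_erase _ _ hs, ← hus,
    Finset.sum_congr rfl fun v hv => by rw [← huv v (Finset.ne_of_mem_erase hv)]]
  omega

lemma IsFlipAt.heightDist_add (h : IsFlipAt s b t u) (t' : Tiling L R) :
    heightDist hR t₀ t t' + (height hR t₀ t s + M.flipSign s b - height hR t₀ t' s).natAbs =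
      heightDist hR t₀ u t' + (height hR t₀ t s - height hR t₀ t' s).natAbs :=
  heightDist_add_single (M.flipSign_ne_zero s b) (isFlipAt_iff_height.1 h)

lemma heightDist_le_of_adj (t' : Tiling L R) (h : (flipGraph L R).Adj t u) :
    heightDist hR t₀ t t' ≤ heightDist hR t₀ u t' + 1 := by
  obtain ⟨s, b, h⟩ := (adj_iff_exists_isFlip hR).1 h
  have := IsFlipAt.heightDist_add (hR := hR) (t₀ := t₀) h t'
  have := M.flipSign_eq_one_or_neg_one s b
  omega

lemma heightDist_le_length (p : (flipGraph L R).Walk t t') :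
    heightDist hR t₀ t t' ≤ p.length := by
  induction p with
  | nil => simp [heightDist]
  | cons h p ih =>
    rw [SimpleGraph.Walk.length_cons]
    exact (heightDist_le_of_adj _ h).trans (Nat.add_le_add_right ih 1)

lemma exists_adj_of_height_lt {v : L.Site} (hv : height hR t₀ t v < height hR t₀ t' v) :
    ∃ u, (flipGraph L R).Adj t u ∧ heightDist hR t₀ t t' = heightDist hR t₀ u t' + 1 := by
  obtain ⟨s, hs, h⟩ :=
    exists_isHeight_add_one hR (isHeight_height (hR := hR) t) (isHeight_height t') hv
  obtain ⟨u, hu⟩ := h.exists_height_eq hR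
  refine ⟨u, (adj_iff_exists_isFlip hR).2
    ⟨s, isFlip_iff_height.2 ⟨M.up s, by rw [hu, flipSign_up]⟩⟩, ?_⟩
  have := heightDist_add_single (t' := t') one_ne_zero hu
  omega

theorem exists_walk_length_eq (t t' : Tiling L R) :
    ∃ p : (flipGraph L R).Walk t t', p.length = heightDist hR t₀ t t' := by
  induction hn : heightDist hR t₀ t t' generalizing t t' with
  | zero =>
    obtain rfl := eq_of_heightDist_eq_zero hn
    exact ⟨.nil, rfl⟩
  | succ n ih =>
    have hne : height hR t₀ t ≠ height hR t₀ t' := fun h => by simp [heightDist, h] at hn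
    obtain ⟨v, hv⟩ := Function.ne_iff.1 hne
    rcases lt_or_gt_of_ne hv with hv | hv
    · obtain ⟨u, htu, hu⟩ := exists_adj_of_height_lt hv
      obtain ⟨p, hp⟩ := ih u t' (by omega)
      exact ⟨.cons htu p, by rw [SimpleGraph.Walk.length_cons, hp]⟩
    · obtain ⟨u, htu, hu⟩ := exists_adj_of_height_lt hv
      rw [heightDist_comm t', heightDist_comm u] at hu
      obtain ⟨p, hp⟩ := ih t u (by omega)
      exact ⟨p.concat htu.symm, by rw [SimpleGraph.Walk.length_concat, hp]⟩

theorem dist_eq_heightDist (t t' : Tiling L R) :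
    (flipGraph L R).dist t t' = heightDist hR t₀ t t' := by
  obtain ⟨p, hp⟩ := exists_walk_length_eq (hR := hR) (t₀ := t₀) t t'
  refine le_antisymm (hp ▸ SimpleGraph.dist_le p) ?_
  obtain ⟨q, hq⟩ := SimpleGraph.Reachable.exists_walk_length_eq_dist ⟨p⟩
  exact hq ▸ heightDist_le_length q

lemma height_tgt_le_of_height_src_lt {e : M.Edge} (he : M.tile e ∈ t.tiles)
    (h : height hR t₀ t (M.src e) < height hR t₀ t' (M.src e)) :
    height hR t₀ t (M.tgt e) ≤ height hR t₀ t' (M.tgt e) := by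
  have hsub := height_sub (hR := hR) (t₀ := t₀) t e
  have hsub' := height_sub (hR := hR) (t₀ := t₀) t' e
  rw [ind_eq_one_iff.2 he] at hsub
  have := ind_eq_zero_or_one t' e
  omega

/-- If the sites shared a face, a tile of `t` would cross an edge which leaves or enters both of
them, or leaves one and enters the other. -/
theorem disjoint_support_of_heightDist (hs : IsFlipAt s b t u) (hs' : IsFlipAt s' b' t u')
    (hu : heightDist hR t₀ t t' = heightDist hR t₀ u t' + 1)
    (hu' : heightDist hR t₀ t t' = heightDist hR t₀ u' t' + 1) (hne : u ≠ u') :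
    Disjoint (support L s) (support L s') := by
  have hd := IsFlipAt.heightDist_add (hR := hR) (t₀ := t₀) hs t'
  have hd' := IsFlipAt.heightDist_add (hR := hR) (t₀ := t₀) hs' t'
  have ne_site : s ≠ s' := by
    rintro rfl
    have := M.flipSign_eq_one_or_neg_one s b
    have := M.flipSign_eq_one_or_neg_one s b'
    have hsign : M.flipSign s b = M.flipSign s b' := by omega
    refine hne (height_injective (hR := hR) (t₀ := t₀) ?_)
    rw [isFlipAt_iff_height.1 hs, isFlipAt_iff_height.1 hs', hsign]
  by_contra hc
  obtain ⟨e, he, he'⟩ := exists_common_edge hs.1 hs'.1 hc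
  have hcross := height_tgt_le_of_height_src_lt (hR := hR) (t₀ := t₀) (t' := t') (hs.1 he)
  rcases M.eq_up_or_eq_not_up s b with rfl | rfl <;>
    rcases M.eq_up_or_eq_not_up s' b' with rfl | rfl <;>
    simp only [tile_mem_filling_up, tile_mem_filling_not_up] at he he' <;>
    subst he he' <;>
    simp only [flipSign_up, flipSign_not_up] at hd hd'
  · exact ne_site rfl
  · omega
  · omega
  · exact ne_site rfl

lemma ne_of_disjoint_support (M : DualGraph L) (h : Disjoint (support L s) (support L s')) :
    s ≠ s' := by
  rintro rfl
  obtain ⟨e, rfl⟩ := M.src_surjective s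
  have hmem := mem_support_src (left_mem_tile e)
  exact Finset.disjoint_left.1 h hmem hmem

theorem exists_isFlipAt_isFlipAt (hR : M.NoHoles R) (h : Disjoint (support L s) (support L s'))
    (hs : IsFlipAt s b t u) (hs' : IsFlipAt s' b' t u') :
    ∃ c, IsFlipAt s' b' u c ∧ IsFlipAt s b u' c := by
  have hne := M.ne_of_disjoint_support h
  have hu := (isFlipAt_iff_height (hR := hR) (t₀ := t)).1 hs
  have hu' := (isFlipAt_iff_height (hR := hR) (t₀ := t)).1 hs'
  have hc : M.IsHeight t
      (height hR t t + Pi.single s (M.flipSign s b) + Pi.single s' (M.flipSign s' b')) := by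
    refine IsHeight.of_pairwiseDisjoint (S := {s, s'})
      (σ := fun v => if v = s then M.flipSign s b else M.flipSign s' b')
      ((Set.pairwiseDisjoint_singleton _ _).insert fun v hv _ => hv ▸ h)
      (isHeight_height (hR := hR) t) ?_ fun v => ?_
    · rintro v (rfl | rfl)
      · rw [if_pos rfl, ← hu]
        exact isHeight_height u
      · rw [if_neg hne.symm, ← hu']
        exact isHeight_height u'
    · by_cases hv : v = s
      · simp [hv, hne]
      · by_cases hv' : v = s' <;> simp [hv, hv', hne.symm]
  obtain ⟨c, hc⟩ := hc.exists_height_eq hR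
  exact ⟨c, (isFlipAt_iff_height (hR := hR) (t₀ := t)).2 (by rw [hc, hu]),
    (isFlipAt_iff_height (hR := hR) (t₀ := t)).2 (by rw [hc, hu', add_right_comm])⟩

theorem exists_square_of_heightDist (htu : (flipGraph L R).Adj t u)
    (htu' : (flipGraph L R).Adj t u') (hu : heightDist hR t₀ t t' = heightDist hR t₀ u t' + 1)
    (hu' : heightDist hR t₀ t t' = heightDist hR t₀ u' t' + 1) (hne : u ≠ u') :
    ∃ c s s', Disjoint (support L s) (support L s') ∧ IsFlip s t u ∧ IsFlip s' u c ∧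
      IsFlip s' t u' ∧ IsFlip s u' c ∧ heightDist hR t₀ u t' = heightDist hR t₀ c t' + 1 := by
  obtain ⟨s, b, hs⟩ := (adj_iff_exists_isFlip hR).1 htu
  obtain ⟨s', b', hs'⟩ := (adj_iff_exists_isFlip hR).1 htu'
  have hdisj := disjoint_support_of_heightDist hs hs' hu hu' hne
  obtain ⟨c, hc, hc'⟩ := exists_isFlipAt_isFlipAt hR hdisj hs hs'
  refine ⟨c, s, s', hdisj, ⟨b, hs⟩, ⟨b', hc⟩, ⟨b', hs'⟩, ⟨b, hc'⟩, ?_⟩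
  have hd := IsFlipAt.heightDist_add (hR := hR) (t₀ := t₀) hs' t'
  have hd' := IsFlipAt.heightDist_add (hR := hR) (t₀ := t₀) hc t'
  have hus' : height hR t₀ u s' = height hR t₀ t s' := by
    rw [isFlipAt_iff_height.1 hs, Pi.add_apply,
      Pi.single_eq_of_ne (M.ne_of_disjoint_support hdisj).symm, add_zero]
  rw [hus'] at hd'
  omega

theorem equivalent_of_length_eq (n : ℕ) (p q : (flipGraph L R).Walk t t')
    (hn : heightDist hR t₀ t t' = n) (hp : p.length = n) (hq : q.length = n) :
    Equivalent p q := by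
  induction n generalizing t t' with
  | zero =>
    obtain rfl := SimpleGraph.Walk.eq_of_length_eq_zero hp
    rw [(SimpleGraph.Walk.length_eq_zero_iff.1 hp).eq_nil,
      (SimpleGraph.Walk.length_eq_zero_iff.1 hq).eq_nil]
    exact .refl _
  | succ n ih =>
    obtain _ | @⟨_, u, _, hu, p⟩ := p
    · simp at hp
    obtain _ | @⟨_, u', _, hu', q⟩ := q
    · simp at hq
    rw [SimpleGraph.Walk.length_cons, Nat.add_right_cancel_iff] at hp hq
    have hdu : heightDist hR t₀ u t' = n := le_antisymm (hp ▸ heightDist_le_length p)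
      (by have := heightDist_le_of_adj (hR := hR) (t₀ := t₀) t' hu; omega)
    have hdu' : heightDist hR t₀ u' t' = n := le_antisymm (hq ▸ heightDist_le_length q)
      (by have := heightDist_le_of_adj (hR := hR) (t₀ := t₀) t' hu'; omega)
    obtain rfl | hne := eq_or_ne u u'
    · exact (ih p q hdu hp hq).cons hu
    obtain ⟨c, s, s', hdisj, hs, fuc, hs', fuc', hdc⟩ :=
      exists_square_of_heightDist (hR := hR) (t₀ := t₀) (t' := t') hu hu' (by omega) (by omega) hne
    obtain ⟨r, hr⟩ := exists_walk_length_eq (hR := hR) (t₀ := t₀) c t'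
    have huc := (adj_iff_exists_isFlip hR).2 ⟨s', fuc⟩
    have huc' := (adj_iff_exists_isFlip hR).2 ⟨s, fuc'⟩
    have hlen : r.length + 1 = n := by omega
    have hpr := (ih p (.cons huc r) hdu hp (by rw [SimpleGraph.Walk.length_cons, hlen])).cons hu
    have hrq := (ih (.cons huc' r) q hdu' (by rw [SimpleGraph.Walk.length_cons, hlen]) hq).cons hu'
    have hswap : Swap (.cons hu (.cons huc r)) (.cons hu' (.cons huc' r)) :=
      ⟨t, u, u', c, .nil, r, hu, huc, hu', huc', s, s', hdisj, hs, fuc, hs', fuc', rfl, rfl⟩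
    exact .trans _ _ _ hpr (.trans _ _ _ (.rel _ _ hswap) hrq)

theorem equivalent_of_isGeodesic (hR : M.NoHoles R) {p q : (flipGraph L R).Walk t t'}
    (hp : IsGeodesic p) (hq : IsGeodesic q) : Equivalent p q :=
  equivalent_of_length_eq (hR := hR) (t₀ := t) _ p q (dist_eq_heightDist t t').symm hp hq

end DualGraph

/-! ### Contraction of the flip complex -/

lemma finite_tiling (L : TileSystem) (R : Finset L.Face) : Finite (Tiling L R) :=
  .of_injective (β := {T // T ∈ R.powerset.powerset})
    (fun t => ⟨t.tiles, Finset.mem_powerset.2 fun d hd => Finset.mem_powerset.2 (t.subset d hd)⟩)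
    fun _ _ h => Tiling.ext (congrArg Subtype.val h)

lemma exists_glue {L : TileSystem} {R : Finset L.Face} {p : Cubes L R} {s : L.Site}
    (hs : s ∈ p.1.sites) {t : Tiling L R}
    (ht : ∀ r ∈ p.1.sites.erase s, L.filling r false ⊆ t.tiles)
    (h : (p.2 ⟨s, hs⟩ = 0 ∧ t = p.1.corner) ∨ (p.2 ⟨s, hs⟩ = 1 ∧ IsFlip s p.1.corner t)) :
    ∃ q, Glue p q :=
  ⟨⟨⟨t, p.1.sites.erase s, ht, p.1.independent.subset (Finset.erase_subset s _)⟩,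
    fun r => p.2 ⟨r, Finset.mem_of_mem_erase r.2⟩⟩, s, hs, rfl, fun _ _ _ => rfl, h⟩

/-- The point lies in the interior of its cube. -/
def IsInteriorPoint {L : TileSystem} {R : Finset L.Face} (p : Cubes L R) : Prop :=
  ∀ s, p.2 s ∈ Set.Ioo 0 1

namespace DualGraph

variable {L : TileSystem} {M : DualGraph L} {R : Finset L.Face} {hR : M.NoHoles R}
  {t₀ t t' : Tiling L R} {s : L.Site} {b : Bool}

lemma finite_cell (M : DualGraph L) (R : Finset L.Face) : Finite (Cell L R) := by
  have := finite_tiling L R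
  refine .of_injective
    (β := Tiling L R × {S // S ∈ (M.finite_interior R).toFinset.powerset})
    (fun c => (c.corner, ⟨c.sites, Finset.mem_powerset.2 fun s hs =>
      (M.finite_interior R).mem_toFinset.2 (interior_of_filling_subset (c.flippable s hs))⟩)) ?_
  rintro ⟨c, S, h₁, h₂⟩ ⟨c', S', h₁', h₂'⟩ h
  simp only [Prod.mk.injEq, Subtype.mk.injEq] at h
  obtain ⟨rfl, rfl⟩ := h
  rfl

lemma exists_isFlipAt (hR : M.NoHoles R) (hb : L.filling s b ⊆ t.tiles) :
    ∃ t' : Tiling L R, IsFlipAt s b t t' := by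
  obtain ⟨t', ht'⟩ :=
    (isHeight_add_of_filling_subset (hR := hR) (t₀ := t) hb).exists_height_eq hR
  exact ⟨t', isFlipAt_iff_height.2 ht'⟩

lemma filling_subset_iff_isHeight : L.filling s b ⊆ t.tiles ↔
    M.IsHeight t₀ (height hR t₀ t + Pi.single s (M.flipSign s b)) := by
  refine ⟨isHeight_add_of_filling_subset, fun h => ?_⟩
  obtain ⟨t', ht'⟩ := h.exists_height_eq hR
  exact (isFlipAt_iff_height.2 ht').1

lemma isFlipAt_of_isFlip (M : DualGraph L) (hb : L.filling s b ⊆ t.tiles) (h : IsFlip s t t') :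
    IsFlipAt s b t t' := by
  obtain ⟨b', h⟩ := h
  obtain rfl | rfl : b' = b ∨ b' = !b := by cases b <;> cases b' <;> simp
  · exact h
  · obtain ⟨e, rfl⟩ := M.src_surjective s
    obtain ⟨e', he', -⟩ := (mem_support (M := M) b).1 (mem_support_src (left_mem_tile e))
    exact absurd (hb he') (tile_notMem_of_filling_subset h.1 (by rwa [Bool.not_not]))

lemma exists_glue_of_eq_zero_or_eq_one (hR : M.NoHoles R) {p : Cubes L R} (hs : s ∈ p.1.sites)
    (h : p.2 ⟨s, hs⟩ = 0 ∨ p.2 ⟨s, hs⟩ = 1) : ∃ q, Glue p q := by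
  rcases h with h | h
  · exact exists_glue hs (fun r hr => p.1.flippable r (Finset.mem_of_mem_erase hr)) (.inl ⟨h, rfl⟩)
  · obtain ⟨t, ht⟩ := exists_isFlipAt hR (p.1.flippable s hs)
    refine exists_glue hs (fun r hr => ?_) (.inr ⟨h, false, ht⟩)
    obtain ⟨hrs, hr⟩ := Finset.mem_erase.1 hr
    obtain ⟨u, hu⟩ := exists_isFlipAt hR (p.1.flippable r hr)
    obtain ⟨c, hc, -⟩ := exists_isFlipAt_isFlipAt hR (p.1.independent hs hr hrs.symm) ht hu
    exact hc.1

theorem exists_isInteriorPoint (hR : M.NoHoles R) (p : Cubes L R) :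
    ∃ q : Cubes L R, Quot.mk Glue p = Quot.mk Glue q ∧ IsInteriorPoint q := by
  induction hn : p.1.sites.card generalizing p with
  | zero =>
    rw [Finset.card_eq_zero] at hn
    exact ⟨p, rfl, fun s => absurd s.2 (by simp [hn])⟩
  | succ n ih =>
    by_cases hp : IsInteriorPoint p
    · exact ⟨p, rfl, hp⟩
    obtain ⟨⟨s, hs⟩, hps⟩ := not_forall.1 hp
    have hface : p.2 ⟨s, hs⟩ = 0 ∨ p.2 ⟨s, hs⟩ = 1 := by
      by_contra! hc
      exact hps ⟨unitInterval.pos_iff_ne_zero.2 hc.1, unitInterval.lt_one_iff_ne_one.2 hc.2⟩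
    obtain ⟨q, hpq⟩ := exists_glue_of_eq_zero_or_eq_one hR hs hface
    obtain ⟨r, hr, hsites, -⟩ := id hpq
    have hcard : q.1.sites.card = n := by
      rw [hsites, Finset.card_erase_of_mem hr, hn, add_tsub_cancel_right]
    obtain ⟨q', hq', h⟩ := ih q hcard
    exact ⟨q', (Quot.sound hpq).trans hq', h⟩

/-- The map of the cubes to the space of real functions on the vertices which extends the height
functions affinely. -/
noncomputable def realize (hR : M.NoHoles R) (t₀ : Tiling L R) (p : Cubes L R) : L.Site → ℝ :=
  fun s => height hR t₀ p.1.corner s +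
    if hs : s ∈ p.1.sites then (M.flipSign s false : ℝ) * (p.2 ⟨s, hs⟩ : ℝ) else 0

lemma realize_of_mem {p : Cubes L R} (hs : s ∈ p.1.sites) :
    realize hR t₀ p s = height hR t₀ p.1.corner s + M.flipSign s false * (p.2 ⟨s, hs⟩ : ℝ) := by
  rw [realize, dif_pos hs]

lemma realize_of_notMem {p : Cubes L R} (hs : s ∉ p.1.sites) :
    realize hR t₀ p s = height hR t₀ p.1.corner s := by
  rw [realize, dif_neg hs, add_zero]

theorem realize_eq_of_glue {p q : Cubes L R} (h : Glue p q) :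
    realize hR t₀ p = realize hR t₀ q := by
  obtain ⟨s, hs, hsites, hx, hc⟩ := h
  have height_of_flip (hflip : IsFlip s p.1.corner q.1.corner) :
      height hR t₀ q.1.corner = height hR t₀ p.1.corner + Pi.single s (M.flipSign s false) :=
    isFlipAt_iff_height.1 (M.isFlipAt_of_isFlip (p.1.flippable s hs) hflip)
  funext v
  obtain rfl | hv := eq_or_ne v s
  · rw [realize_of_mem hs, realize_of_notMem (p := q) (by simp [hsites])]
    rcases hc with ⟨hzero, hc⟩ | ⟨hone, hc⟩
    · rw [hzero, hc, Set.Icc.coe_zero, mul_zero, add_zero]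
    · rw [hone, height_of_flip hc, Pi.add_apply, Pi.single_eq_same, Set.Icc.coe_one, mul_one,
        Int.cast_add]
  · have hcv : height hR t₀ q.1.corner v = height hR t₀ p.1.corner v := by
      rcases hc with ⟨-, hc⟩ | ⟨-, hc⟩
      · rw [hc]
      · rw [height_of_flip hc, Pi.add_apply, Pi.single_eq_of_ne hv, add_zero]
    have hmem : v ∈ q.1.sites ↔ v ∈ p.1.sites := by simp [hsites, hv]
    by_cases hvp : v ∈ p.1.sites
    · rw [realize_of_mem hvp, realize_of_mem (hmem.2 hvp), hcv, hx v hvp (hmem.2 hvp)]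
    · rw [realize_of_notMem hvp, realize_of_notMem (mt hmem.1 hvp), hcv]

lemma continuous_realize : Continuous (realize hR t₀) := by
  refine continuous_sigma fun c => continuous_pi fun s => ?_
  unfold realize
  by_cases hs : s ∈ c.sites
  · simp only [dif_pos hs]
    exact continuous_const.add (continuous_const.mul
      (continuous_subtype_val.comp (continuous_apply (⟨s, hs⟩ : {r // r ∈ c.sites}))))
  · simp only [dif_neg hs, continuous_const]

/-- The coordinate of a cube at the site `s`, reversed where the flip lowers the height. -/
noncomputable def ascending (M : DualGraph L) (s : L.Site) (x : unitInterval) : unitInterval :=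
  if M.flipSign s false = 1 then x else unitInterval.symm x

/-- The difference between the heights of the lowest corner of a cube with sites `S` and those of
the corner where all sites carry the filling `false`. -/
noncomputable def drop (M : DualGraph L) (S : Set L.Site) : L.Site → ℤ :=
  S.indicator fun s => min 0 (M.flipSign s false)

lemma drop_of_mem {S : Set L.Site} (hs : s ∈ S) : M.drop S s = min 0 (M.flipSign s false) :=
  Set.indicator_of_mem hs _

lemma drop_of_notMem {S : Set L.Site} (hs : s ∉ S) : M.drop S s = 0 := Set.indicator_of_notMem hs _

lemma ascending_ascending (M : DualGraph L) (s : L.Site) (x : unitInterval) :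
    M.ascending s (M.ascending s x) = x := by
  unfold ascending
  split_ifs
  · rfl
  · exact unitInterval.symm_symm x

lemma ascending_mem_Ioo {x : unitInterval} (hx : x ∈ Set.Ioo 0 1) :
    M.ascending s x ∈ Set.Ioo 0 1 := by
  unfold ascending
  split_ifs
  · exact hx
  · simpa [and_comm, unitInterval.lt_one_iff_ne_one, unitInterval.pos_iff_ne_zero] using hx

lemma flipSign_mul_eq (M : DualGraph L) (s : L.Site) (x : unitInterval) :
    (M.flipSign s false : ℝ) * x = (min 0 (M.flipSign s false) : ℤ) + (M.ascending s x : ℝ) := by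
  rcases M.flipSign_eq_one_or_neg_one s false with h | h
  · simp [ascending, h]
  · rw [ascending, if_neg (by omega), unitInterval.coe_symm_eq, h, min_eq_right (by norm_num)]
    push_cast
    ring

lemma realize_eq_add_ascending {p : Cubes L R} (hs : s ∈ p.1.sites) :
    realize hR t₀ p s =
      ((height hR t₀ p.1.corner + M.drop p.1.sites) s : ℤ) + (M.ascending s (p.2 ⟨s, hs⟩) : ℝ) := by
  rw [realize_of_mem hs, flipSign_mul_eq, Pi.add_apply,
    drop_of_mem (Finset.mem_coe.2 hs), Int.cast_add, add_assoc]

lemma floor_realize {p : Cubes L R} (hp : IsInteriorPoint p) :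
    (fun v => ⌊realize hR t₀ p v⌋) = height hR t₀ p.1.corner + M.drop p.1.sites := by
  funext v
  by_cases hv : v ∈ p.1.sites
  · obtain ⟨-, hlt⟩ := ascending_mem_Ioo (M := M) (s := v) (hp ⟨v, hv⟩)
    rw [realize_eq_add_ascending hv, Int.floor_intCast_add,
      Int.floor_eq_zero_iff.2 ⟨unitInterval.nonneg _, hlt⟩, add_zero]
  · rw [realize_of_notMem hv, Int.floor_intCast, Pi.add_apply,
      drop_of_notMem (mt Finset.mem_coe.1 hv), add_zero]

lemma fract_realize_ne_zero_iff {p : Cubes L R} (hp : IsInteriorPoint p) :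
    Int.fract (realize hR t₀ p s) ≠ 0 ↔ s ∈ p.1.sites := by
  by_cases hs : s ∈ p.1.sites
  · obtain ⟨hpos, hlt⟩ := ascending_mem_Ioo (M := M) (s := s) (hp ⟨s, hs⟩)
    rw [realize_eq_add_ascending hs, Int.fract_intCast_add,
      Int.fract_eq_self.2 ⟨unitInterval.nonneg _, hlt⟩]
    exact iff_of_true (unitInterval.coe_ne_zero.2 hpos.ne') hs
  · rw [realize_of_notMem hs, Int.fract_intCast]
    exact iff_of_false (not_not.2 rfl) hs

theorem eq_of_realize_eq {p q : Cubes L R} (hp : IsInteriorPoint p) (hq : IsInteriorPoint q)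
    (h : realize hR t₀ p = realize hR t₀ q) : p = q := by
  have hsites : p.1.sites = q.1.sites := Finset.ext fun s => by
    rw [← fract_realize_ne_zero_iff (hR := hR) (t₀ := t₀) hp, h, fract_realize_ne_zero_iff hq]
  have hcorner : p.1.corner = q.1.corner := by
    have hfloor := floor_realize (hR := hR) (t₀ := t₀) hp
    rw [h, floor_realize hq, hsites] at hfloor
    exact height_injective (hR := hR) (t₀ := t₀) (add_right_cancel hfloor).symm
  obtain ⟨⟨c, S, hS, hS'⟩, x⟩ := p
  obtain ⟨⟨c', S', hT, hT'⟩, y⟩ := q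
  dsimp only at hsites hcorner
  subst hsites hcorner
  refine Sigma.ext rfl (heq_of_eq (funext fun s => Subtype.ext ?_))
  have hs := congrFun h s
  rw [realize_of_mem (p := ⟨⟨c, S, hS, hS'⟩, x⟩) s.2,
    realize_of_mem (p := ⟨⟨c, S, hT, hT'⟩, y⟩) s.2] at hs
  exact mul_left_cancel₀ (Int.cast_ne_zero.2 (M.flipSign_ne_zero s false)) (add_left_cancel hs)

/-- The image of the flip complex in the space of real functions on the vertices: the lowest corner
of the cube of `y` has the heights `⌊y⌋`, and the sites of the cube are where `y` is not an
integer. -/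
def realization (M : DualGraph L) (t₀ : Tiling L R) : Set (L.Site → ℝ) :=
  {y | M.IsHeight t₀ (fun v => ⌊y v⌋) ∧
    ∀ u, Int.fract (y u) ≠ 0 → M.IsHeight t₀ ((fun v => ⌊y v⌋) + Pi.single u 1)}

lemma realize_mem_realization_of_isInteriorPoint {p : Cubes L R} (hp : IsInteriorPoint p) :
    realize hR t₀ p ∈ M.realization t₀ := by
  have hflip (s) (hs : s ∈ (p.1.sites : Set L.Site)) :
      M.IsHeight t₀ (height hR t₀ p.1.corner + Pi.single s (M.flipSign s false)) :=
    filling_subset_iff_isHeight.1 (p.1.flippable s hs)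
  rw [realization, Set.mem_ofPred_eq, floor_realize hp]
  refine ⟨.of_pairwiseDisjoint p.1.independent (isHeight_height p.1.corner) hflip fun v => ?_,
    fun u hu => .of_pairwiseDisjoint p.1.independent (isHeight_height p.1.corner) hflip fun v => ?_⟩
  · have := M.flipSign_eq_one_or_neg_one v false
    simp only [Pi.add_apply]
    grind [drop_of_mem, drop_of_notMem]
  · have := M.flipSign_eq_one_or_neg_one v false
    have hus := (fract_realize_ne_zero_iff hp).1 hu
    simp only [Pi.add_apply, Pi.single_apply]
    grind [drop_of_mem, drop_of_notMem]

lemma realize_mem_realization (p : Cubes L R) : realize hR t₀ p ∈ M.realization t₀ := by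
  obtain ⟨q, hpq, hq⟩ := exists_isInteriorPoint hR p
  have hrealize : realize hR t₀ p = realize hR t₀ q :=
    congrArg (Quot.lift (realize hR t₀) fun _ _ => realize_eq_of_glue) hpq
  exact hrealize ▸ realize_mem_realization_of_isInteriorPoint hq

lemma interior_of_mem_realization {y : L.Site → ℝ} (hy : y ∈ M.realization t₀)
    (hs : Int.fract (y s) ≠ 0) : M.Interior R s := by
  by_contra hc
  have hfloor : ⌊y s⌋ = 0 := hy.1.1 s hc
  have hadd := (hy.2 s hs).1 s hc
  rw [Pi.add_apply, Pi.single_eq_same, hfloor] at hadd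
  exact one_ne_zero hadd

lemma pairwiseDisjoint_of_mem_realization (hR : M.NoHoles R) {y : L.Site → ℝ}
    (hy : y ∈ M.realization t₀) : {u | Int.fract (y u) ≠ 0}.PairwiseDisjoint (support L) :=
  fun u hu v hv huv => disjoint_support_of_isHeight_add_one hR hy.1 (hy.2 u hu) (hy.2 v hv) huv

lemma exists_corner_of_mem_realization (hR : M.NoHoles R) {y : L.Site → ℝ}
    (hy : y ∈ M.realization t₀) : ∃ c : Tiling L R,
      height hR t₀ c = (fun v => ⌊y v⌋) - M.drop {u | Int.fract (y u) ≠ 0} ∧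
        ∀ s, Int.fract (y s) ≠ 0 → L.filling s false ⊆ c.tiles := by
  have hdisj := pairwiseDisjoint_of_mem_realization hR hy
  have hcorner : M.IsHeight t₀ ((fun v => ⌊y v⌋) - M.drop {u | Int.fract (y u) ≠ 0}) := by
    refine .of_pairwiseDisjoint (σ := fun _ => 1) hdisj hy.1 hy.2 fun v => ?_
    have := M.flipSign_eq_one_or_neg_one v false
    simp only [Pi.sub_apply]
    grind [drop_of_mem, drop_of_notMem]
  obtain ⟨c, hc⟩ := hcorner.exists_height_eq hR
  refine ⟨c, hc, fun s hs => (filling_subset_iff_isHeight (hR := hR) (t₀ := t₀)).2 ?_⟩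
  rw [hc]
  refine .of_pairwiseDisjoint (σ := fun _ => 1) hdisj hy.1 hy.2 fun v => ?_
  have := M.flipSign_eq_one_or_neg_one v false
  simp only [Pi.add_apply, Pi.sub_apply, Pi.single_apply]
  grind [drop_of_mem, drop_of_notMem]

theorem exists_realize_eq (hR : M.NoHoles R) {y : L.Site → ℝ} (hy : y ∈ M.realization t₀) :
    ∃ p : Cubes L R, realize hR t₀ p = y := by
  have hfin : {u | Int.fract (y u) ≠ 0}.Finite :=
    (M.finite_interior R).subset fun u => interior_of_mem_realization hy
  obtain ⟨c, hc, hflip⟩ := exists_corner_of_mem_realization hR hy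
  set frac : L.Site → unitInterval := fun s =>
    ⟨Int.fract (y s), Int.fract_nonneg _, (Int.fract_lt_one _).le⟩
  refine ⟨⟨⟨c, hfin.toFinset, fun s hs => hflip s (hfin.mem_toFinset.1 hs),
    by simpa using pairwiseDisjoint_of_mem_realization hR hy⟩, fun s => M.ascending s (frac s)⟩,
    funext fun s => ?_⟩
  by_cases hs : s ∈ hfin.toFinset
  · rw [realize_eq_add_ascending hs, ascending_ascending, hc]
    simp only [Set.Finite.coe_toFinset, sub_add_cancel]
    exact Int.floor_add_fract (y s)
  · have hfract := Set.notMem_ofPred_iff.1 (mt hfin.mem_toFinset.2 hs)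
    rw [realize_of_notMem hs, hc, Pi.sub_apply, drop_of_notMem hfract, sub_zero]
    exact (sub_eq_zero.1 ((Int.self_sub_floor (y s)).trans (not_not.1 hfract))).symm

/-- The flip complex is homeomorphic to its image in the space of real functions. -/
noncomputable def complexHomeomorph (hR : M.NoHoles R) (t₀ : Tiling L R) :
    Complex L R ≃ₜ M.realization t₀ :=
  haveI := M.finite_cell R
  Continuous.homeoOfEquivCompactToT2 (f := Equiv.ofBijective
    (Quot.lift (fun p => (⟨realize hR t₀ p, realize_mem_realization p⟩ : M.realization t₀))
      fun _ _ h => Subtype.ext (realize_eq_of_glue h)) ⟨by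
        rintro ⟨p⟩ ⟨q⟩ h
        obtain ⟨p', hp, hp'⟩ := exists_isInteriorPoint hR p
        obtain ⟨q', hq, hq'⟩ := exists_isInteriorPoint hR q
        rw [hp, hq] at h ⊢
        exact congrArg _ (eq_of_realize_eq hp' hq' (congrArg Subtype.val h)), by
        rintro ⟨y, hy⟩
        obtain ⟨p, hp⟩ := exists_realize_eq hR hy
        exact ⟨Quot.mk _ p, Subtype.ext hp⟩⟩)
    (continuous_quot_lift _ (continuous_realize.subtype_mk _))

variable {h h' : L.Site → ℤ} {u : L.Site} {y z : L.Site → ℝ}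

lemma finite_isHeight (hR : M.NoHoles R) (t₀ : Tiling L R) : Finite {h // M.IsHeight t₀ h} := by
  have := finite_tiling L R
  refine .of_surjective (α := Tiling L R) (fun t => ⟨height hR t₀ t, isHeight_height t⟩) ?_
  rintro ⟨h, hh⟩
  obtain ⟨t, ht⟩ := hh.exists_height_eq hR
  exact ⟨t, Subtype.ext ht⟩

lemma exists_max_height (hR : M.NoHoles R) (t₀ : Tiling L R) :
    ∃ m, M.IsHeight t₀ m ∧ ∀ h, M.IsHeight t₀ h → h ≤ m := by
  have := finite_isHeight hR t₀
  have : Nonempty {h // M.IsHeight t₀ h} := ⟨⟨_, isHeight_height (hR := hR) t₀⟩⟩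
  have : IsDirected {h // M.IsHeight t₀ h} (· ≤ ·) :=
    ⟨fun a b => ⟨⟨_, a.2.sup b.2⟩, le_sup_left (a := a.1), le_sup_right (b := b.1)⟩⟩
  obtain ⟨m, hm⟩ := Finite.exists_le (id : {h // M.IsHeight t₀ h} → _)
  exact ⟨m.1, m.2, fun h hh => hm ⟨h, hh⟩⟩

lemma exists_min_height (hR : M.NoHoles R) (t₀ : Tiling L R) :
    ∃ m, M.IsHeight t₀ m ∧ ∀ h, M.IsHeight t₀ h → m ≤ h := by
  have := finite_isHeight hR t₀
  have : Nonempty {h // M.IsHeight t₀ h} := ⟨⟨_, isHeight_height (hR := hR) t₀⟩⟩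
  have : IsDirected {h // M.IsHeight t₀ h} (· ≥ ·) :=
    ⟨fun a b => ⟨⟨_, a.2.inf b.2⟩, inf_le_left (a := a.1), inf_le_right (b := b.1)⟩⟩
  obtain ⟨m, hm⟩ := Finite.exists_ge (id : {h // M.IsHeight t₀ h} → _)
  exact ⟨m.1, m.2, fun h hh => hm ⟨h, hh⟩⟩

lemma isHeight_floor_inf_add_single (hy : y ∈ M.realization t₀) (hz : z ∈ M.realization t₀)
    (hu : Int.fract (y u) ≠ 0) (hyz : y u ≤ z u) :
    M.IsHeight t₀ (((fun v => ⌊y v⌋) ⊓ fun v => ⌊z v⌋) + Pi.single u 1) := by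
  rcases (Int.floor_mono hyz).lt_or_eq with hlt | heq
  · convert (hy.2 u hu).inf hz.1 using 1
    funext v
    simp only [Pi.add_apply, Pi.inf_apply]
    obtain rfl | hv := eq_or_ne v u
    · rw [Pi.single_eq_same]
      omega
    · rw [Pi.single_eq_of_ne hv, add_zero, add_zero]
  · have hzu : Int.fract (z u) ≠ 0 := by
      have hpos := (Int.fract_nonneg (y u)).lt_of_ne' hu
      rw [← Int.self_sub_floor] at hpos ⊢
      rw [heq] at hpos
      linarith
    rw [inf_add]
    exact (hy.2 u hu).inf (hz.2 u hzu)

theorem inf_mem_realization (hy : y ∈ M.realization t₀) (hz : z ∈ M.realization t₀) :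
    y ⊓ z ∈ M.realization t₀ := by
  have hfloor : (fun v => ⌊(y ⊓ z) v⌋) = (fun v => ⌊y v⌋) ⊓ fun v => ⌊z v⌋ :=
    funext fun v => Int.floor_mono.map_inf _ _
  refine ⟨hfloor ▸ hy.1.inf hz.1, fun u hu => ?_⟩
  rw [hfloor]
  rw [Pi.inf_apply] at hu
  rcases le_total (y u) (z u) with hle | hle
  · exact isHeight_floor_inf_add_single hy hz (by rwa [inf_eq_left.2 hle] at hu) hle
  · rw [inf_comm]
    exact isHeight_floor_inf_add_single hz hy (by rwa [inf_eq_right.2 hle] at hu) hle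

lemma intCast_mem_realization (hh : M.IsHeight t₀ h) :
    (fun v => (h v : ℝ)) ∈ M.realization t₀ :=
  ⟨by simpa only [Int.floor_intCast] using hh, fun u hu => absurd (Int.fract_intCast (h u)) hu⟩

lemma add_single_mem_realization (hh : M.IsHeight t₀ h) (hu : M.IsHeight t₀ (h + Pi.single u 1))
    {c : ℝ} (hc : c ∈ Set.Ico 0 1) :
    (fun v => (h v : ℝ)) + Pi.single u c ∈ M.realization t₀ := by
  have hsingle (v) : Pi.single (M := fun _ => ℝ) u c v ∈ Set.Ico 0 1 := by
    rw [Pi.single_apply]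
    split_ifs
    · exact hc
    · simp
  have hfloor : (fun v => ⌊((fun v => (h v : ℝ)) + Pi.single u c : L.Site → ℝ) v⌋) = h :=
    funext fun v => by
      rw [Pi.add_apply, Int.floor_intCast_add, Int.floor_eq_zero_iff.2 (hsingle v), add_zero]
  refine ⟨hfloor.symm ▸ hh, fun v hv => ?_⟩
  obtain rfl | hvu := eq_or_ne v u
  · rwa [hfloor]
  · rw [Pi.add_apply, Pi.single_eq_of_ne hvu, add_zero, Int.fract_intCast] at hv
    exact absurd rfl hv

lemma joinedIn_add_single (hh : M.IsHeight t₀ h) (hu : M.IsHeight t₀ (h + Pi.single u 1)) :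
    JoinedIn (M.realization t₀) (fun v => (h v : ℝ))
      (fun v => ((h + Pi.single u 1 : L.Site → ℤ) v : ℝ)) := by
  have hone : (fun v => (h v : ℝ)) + Pi.single u 1 =
      fun v => ((h + Pi.single u 1 : L.Site → ℤ) v : ℝ) := by
    funext v
    simp [Pi.single_apply]
  have hcont : Continuous fun c : ℝ => (fun v => (h v : ℝ)) + Pi.single u c :=
    continuous_const.add (continuous_single (A := fun _ => ℝ) u)
  refine .ofLine hcont.continuousOn (by simp) hone ?_
  rintro _ ⟨c, ⟨hc, hc'⟩, rfl⟩
  obtain hlt | rfl := hc'.lt_or_eq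
  · exact add_single_mem_realization hh hu ⟨hc, hlt⟩
  · exact Set.mem_of_eq_of_mem hone (intCast_mem_realization hu)

theorem joinedIn_of_le (hR : M.NoHoles R) (hh : M.IsHeight t₀ h) (hh' : M.IsHeight t₀ h')
    (hle : h ≤ h') : JoinedIn (M.realization t₀) (fun v => (h v : ℝ)) (fun v => (h' v : ℝ)) := by
  have := finite_isHeight hR t₀
  lift h to {h // M.IsHeight t₀ h} using hh
  induction h using WellFoundedGT.induction with
  | ind h ih =>
    obtain heq | hne := eq_or_ne h.1 h'
    · rw [heq]
      exact .refl (intCast_mem_realization hh')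
    obtain ⟨v, hv⟩ := Function.ne_iff.1 hne
    obtain ⟨u, hu, hhu⟩ := exists_isHeight_add_one hR h.2 hh' ((hle v).lt_of_ne hv)
    have hlt : h.1 < h.1 + Pi.single u 1 := lt_add_of_pos_right _ (Pi.single_pos.2 one_pos)
    refine (joinedIn_add_single h.2 hhu).trans (ih ⟨_, hhu⟩ hlt fun w => ?_)
    change h.1 w + Pi.single (M := fun _ => ℤ) u 1 w ≤ h' w
    obtain rfl | hw := eq_or_ne w u
    · rwa [Pi.single_eq_same]
    · rw [Pi.single_eq_of_ne hw, add_zero]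
      exact hle w

lemma le_of_mem_realization {m : L.Site → ℤ} (hm : ∀ h, M.IsHeight t₀ h → h ≤ m)
    (hy : y ∈ M.realization t₀) : y ≤ fun v => (m v : ℝ) := by
  intro v
  rw [← Int.ceil_le]
  by_cases hv : Int.fract (y v) = 0
  · rw [← Int.floor_add_fract (y v), hv, add_zero, Int.ceil_intCast]
    exact hm _ hy.1 v
  · refine (Int.ceil_le_floor_add_one (y v)).trans ?_
    have := hm _ (hy.2 v hv) v
    rwa [Pi.add_apply, Pi.single_eq_same] at this

/-- The realization is closed under minima and contains a path from its greatest to its least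
element; taking minima with the points of this path contracts it. -/
theorem contractibleSpace_realization (hR : M.NoHoles R) (t₀ : Tiling L R) :
    ContractibleSpace (M.realization t₀) := by
  obtain ⟨m, hm, hmax⟩ := exists_max_height hR t₀
  obtain ⟨b, hb, hmin⟩ := exists_min_height hR t₀
  obtain ⟨γ, hγ⟩ := (joinedIn_of_le hR hb hm (hmin m hm)).symm
  have hcont : Continuous fun p : unitInterval × M.realization t₀ =>
      (⟨p.2.1 ⊓ γ p.1, inf_mem_realization p.2.2 (hγ p.1)⟩ : M.realization t₀) :=
    .subtype_mk (continuous_pi fun v =>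
      ((continuous_apply v).comp (continuous_subtype_val.comp continuous_snd)).min
        ((continuous_apply v).comp (γ.continuous.comp continuous_fst))) _
  rw [contractible_iff_id_nullhomotopic]
  refine ⟨⟨_, intCast_mem_realization hb⟩, ⟨⟨⟨_, hcont⟩, fun y => Subtype.ext ?_,
    fun y => Subtype.ext ?_⟩⟩⟩
  · change y.1 ⊓ γ 0 = y.1
    rw [γ.source, inf_eq_left]
    exact le_of_mem_realization hmax y.2
  · change y.1 ⊓ γ 1 = _
    rw [γ.target]
    exact inf_eq_right.2 fun v => Int.le_floor.1 (hmin _ y.2.1 v)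

theorem contractibleSpace_complex (hR : M.NoHoles R) (t₀ : Tiling L R) :
    ContractibleSpace (Complex L R) :=
  haveI := contractibleSpace_realization hR t₀
  (complexHomeomorph hR t₀).contractibleSpace

end DualGraph

end FlipComplex

theorem theorem3p3_general {L : FlipComplex.TileSystem} {M : FlipComplex.DualGraph L}
    {R : Finset L.Face} (hR : M.NoHoles R) (hT : Nonempty (FlipComplex.Tiling L R)) :
    ContractibleSpace (FlipComplex.Complex L R) ∧
    (∀ (t t' : FlipComplex.Tiling L R) (p q : (FlipComplex.flipGraph L R).Walk t t'),
      FlipComplex.IsGeodesic p → FlipComplex.IsGeodesic q → FlipComplex.Equivalent p q) ∧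
    (∀ (x : FlipComplex.Complex L R) (γ : Path x x), γ.Homotopic (Path.refl x)) := by
  obtain ⟨t₀⟩ := hT
  have := FlipComplex.DualGraph.contractibleSpace_complex hR t₀
  exact ⟨this, fun _ _ _ _ hp hq => FlipComplex.DualGraph.equivalent_of_isGeodesic hR hp hq,
    fun _ _ => SimplyConnectedSpace.paths_homotopic _ _⟩

theorem theorem3p3 (Λ : FlipComplex.Lattice) (R : Finset Λ.system.Face)
    (hR : SimplyConnectedSpace (FlipComplex.carrier Λ.system R))
    (hT : Nonempty (FlipComplex.Tiling Λ.system R)) :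
    ContractibleSpace (FlipComplex.Complex Λ.system R) ∧
    (∀ (t t' : FlipComplex.Tiling Λ.system R)
      (p q : (FlipComplex.flipGraph Λ.system R).Walk t t'),
      FlipComplex.IsGeodesic p → FlipComplex.IsGeodesic q → FlipComplex.Equivalent p q) ∧
    (∀ (x : FlipComplex.Complex Λ.system R) (γ : Path x x), γ.Homotopic (Path.refl x)) :=
  theorem3p3_general Λ.drawing.noHoles_of_simplyConnectedSpace hT
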